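/- For a finite abelian group $G$ and a positive integer $m$, let $\zeta_m$ be a primitive complex $m$-th root of unity. A function $f : G \to \mathbb{Z}_m$ is called a generalized bent function (GBF) if $$\Bigl|\sum_{x\in G} \zeta_m^{f(x)}\,\chi(x)\Bigr|^2 = |G| \quad\text{for every character } \chi : G \to \mathbb{C}^*.$$ Then for every nonnegative integer $r$ (and every choice of the primitive root of unity $\zeta_{5\cdot 11^r}$) there does not exist a GBF $f : \mathbb{Z}_3^3 \to \mathbb{Z}_{5\cdot 11^r}$. -/

import Mathlib

/-- A function `f : G → ℤ/mℤ` on a finite abelian group `G` is a generalized bent function (GBF),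
with respect to a given primitive `m`-th root of unity `ζ`, if
`|∑ x, ζ ^ f(x) * χ(x)|² = |G|` for every complex character `χ` of `G`. -/
def IsGeneralizedBent {G : Type*} [AddCommGroup G] [Fintype G] {m : ℕ} [NeZero m]
    (ζ : ℂ) (f : G → ZMod m) : Prop :=
  ∀ χ : AddChar G ℂ, ‖∑ x : G, ζ ^ (f x).val * χ x‖ ^ 2 = (Fintype.card G : ℝ)

/-! ### Galois action, Frobenius and units in cyclotomic integers -/

section CyclotomicIntegers

open NumberField

variable {K : Type*} [Field K] [NumberField K] {n : ℕ} [NeZero n] [IsCyclotomicExtension {n} ℚ K]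
  {ζ : 𝓞 K}

/-! Write the values of ζ as powers of a root of unity of order n = 5 · 11 ^ (r + 1). Every
character sum X_χ is then a cyclotomic integer with |X_χ|² = 27.

Trivial character. The automorphism σ : ζ ↦ ζ³ is Frobenius at 3, so it preserves every ideal
dividing a power of 3. Hence σX is X times a unit of absolute value 1, which is ± a root of unity by
Kronecker, and multiplying X by a root of unity gives σX = ±X (`exists_shift_quadratic`). A power of
σ fixes the roots of 11-power order and generates the Galois group of the fifth roots. The minus
sign would make X a multiple of √5, but 5 ∤ 27. The plus sign makes X a difference of two sums of
roots of 11-power order; reducing at 11, where these roots become 1, leaves only 11 and 4 as numbers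
of terms (`quadratic_of_map_eq`). Sort the exponents mod 11: the counts, compared mod 11 along the
orbits of multiplication by 3, show that only the exponents divisible by 11 contribute
(`class_counts`, `descent_step`). This descends to conductor 11, where X is a combination of Gauss
periods and must be α = -4 ± √-11 (`conductor_eleven`).

All characters (`not_exists_family`). Character values are cube roots of unity, hence 1 modulo
primes above 3, so all X_χ agree there. Since α is coprime to its conjugate, α divides every X_χ,
and the quotients differ by cube roots of unity η_χ. Fourier inversion at 0 gives ∑ X_χ = 27 · (root
of unity), so ∑ η_χ is the conjugate of α times a unit. But 27 cube roots of unity sum to 0 modulo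
every prime above 3, and some such prime does not contain the conjugate of α. -/

theorem adjoin_primitiveRoot_eq_top (hζ : IsPrimitiveRoot ζ n) :
    Algebra.adjoin ℤ {ζ} = ⊤ :=
  IsCyclotomicExtension.Rat.adjoin_singleton_eq_top
    (hζ.map_of_injective (f := algebraMap (𝓞 K) K) RingOfIntegers.coe_injective)

theorem ringHom_ext_of_primitiveRoot (hζ : IsPrimitiveRoot ζ n) {S : Type*} [CommRing S]
    {f g : 𝓞 K →+* S} (h : f ζ = g ζ) : f = g := by
  have : f.toIntAlgHom = g.toIntAlgHom :=
    AlgHom.ext_of_adjoin_eq_top (adjoin_primitiveRoot_eq_top hζ) (by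
      intro x hx
      rw [Set.mem_singleton_iff] at hx
      subst hx
      exact h)
  ext x
  exact DFunLike.congr_fun this x

theorem exists_algHom_map_primitiveRoot {ζ : K} (hζ : IsPrimitiveRoot ζ n) {L : Type*} [Field L]
    [CharZero L] {μ : L} (hμ : IsPrimitiveRoot μ n) : ∃ φ : K →ₐ[ℚ] L, φ ζ = μ := by
  have h0 : Polynomial.aeval μ (minpoly ℚ (hζ.powerBasis ℚ).gen) = 0 := by
    have h1 : minpoly ℚ (hζ.powerBasis ℚ).gen = Polynomial.cyclotomic n ℚ := by
      rw [Polynomial.cyclotomic_eq_minpoly_rat hζ (NeZero.pos n)]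
      exact congrArg (minpoly ℚ) (hζ.powerBasis_gen ℚ)
    have h2 := hμ.isRoot_cyclotomic (NeZero.pos n)
    rwa [h1, Polynomial.aeval_def, Polynomial.eval₂_eq_eval_map, Polynomial.map_cyclotomic]
  refine ⟨(hζ.powerBasis ℚ).lift μ h0, ?_⟩
  exact (congrArg _ (hζ.powerBasis_gen ℚ).symm).trans ((hζ.powerBasis ℚ).lift_gen μ h0)

theorem exists_complexEmbedding_map_primitiveRoot (hζ : IsPrimitiveRoot ζ n) {μ : ℂ}
    (hμ : IsPrimitiveRoot μ n) : ∃ φ : 𝓞 K →+* ℂ, Function.Injective φ ∧ φ ζ = μ := by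
  obtain ⟨φ, hφ⟩ := exists_algHom_map_primitiveRoot
    (hζ.map_of_injective (f := algebraMap (𝓞 K) K) RingOfIntegers.coe_injective) hμ
  exact ⟨φ.toRingHom.comp (algebraMap (𝓞 K) K),
    φ.toRingHom.injective.comp RingOfIntegers.coe_injective, hφ⟩

theorem exists_ringHom_primitiveRoot_pow (hζ : IsPrimitiveRoot ζ n) {a : ℕ} (ha : a.Coprime n) :
    ∃ σ : 𝓞 K →+* 𝓞 K, σ ζ = ζ ^ a := by
  have h := hζ.map_of_injective (f := algebraMap (𝓞 K) K) RingOfIntegers.coe_injective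
  obtain ⟨φ, hφ⟩ := exists_algHom_map_primitiveRoot h (h.pow_of_coprime a ha)
  refine ⟨RingOfIntegers.mapRingHom φ.toRingHom, ?_⟩
  exact RingOfIntegers.ext (hφ.trans (map_pow (algebraMap (𝓞 K) K) ζ a).symm)

theorem map_root_of_map_primitiveRoot {R : Type*} [CommRing R] [IsDomain R] {n a : ℕ} [NeZero n]
    {ζ w : R} (hζ : IsPrimitiveRoot ζ n) {σ : R →+* R} (hσ : σ ζ = ζ ^ a) (hw : w ^ n = 1) :
    σ w = w ^ a := by
  obtain ⟨i, -, rfl⟩ := hζ.eq_pow_of_pow_eq_one hw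
  rw [map_pow, hσ, ← pow_mul, ← pow_mul, mul_comm]

theorem exists_conjugation (hζ : IsPrimitiveRoot ζ n) :
    ∃ c : 𝓞 K →+* 𝓞 K, (∀ w, w ^ n = 1 → c w * w = 1) ∧
      (∀ x, c (c x) = x) ∧
      (∀ (φ : 𝓞 K →+* ℂ) (x : 𝓞 K), φ (c x) = starRingEnd ℂ (φ x)) ∧
      (∀ (σ : 𝓞 K →+* 𝓞 K) (x : 𝓞 K), σ (c x) = c (σ x)) := by
  have hn := NeZero.pos n
  obtain ⟨c, hc⟩ := exists_ringHom_primitiveRoot_pow hζ (a := n - 1)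
    ((Nat.coprime_self_sub_left hn).mpr (Nat.coprime_one_left n))
  have key : ∀ w, w ^ n = 1 → c w * w = 1 := fun w hw => by
    rw [map_root_of_map_primitiveRoot hζ hc hw, ← pow_succ, Nat.sub_add_cancel hn, hw]
  have hζn := hζ.pow_eq_one
  refine ⟨c, key, ?_, fun φ => ?_, fun σ => ?_⟩
  · have : c.comp c = RingHom.id _ := ringHom_ext_of_primitiveRoot hζ (by
      have h1 := key ζ hζn
      have h2 := congrArg c h1
      rw [map_mul, map_one] at h2
      change c (c ζ) = ζ
      calc c (c ζ) = c (c ζ) * (c ζ * ζ) := by rw [h1, mul_one]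
        _ = ζ := by rw [← mul_assoc, h2, one_mul])
    exact fun x => DFunLike.congr_fun this x
  · have : φ.comp c = (starRingEnd ℂ).comp φ := ringHom_ext_of_primitiveRoot hζ (by
      change φ (c ζ) = starRingEnd ℂ (φ ζ)
      have h1 : φ (c ζ) * φ ζ = 1 := by rw [← map_mul, key ζ hζn, map_one]
      have h2 : ‖φ ζ‖ = 1 := Complex.norm_eq_one_of_pow_eq_one
        (by rw [← map_pow, hζn, map_one]) hn.ne'
      rw [eq_inv_of_mul_eq_one_left h1, Complex.inv_eq_conj h2])
    exact fun x => DFunLike.congr_fun this x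
  · have : σ.comp c = c.comp σ := ringHom_ext_of_primitiveRoot hζ (by
      change σ (c ζ) = c (σ ζ)
      have h1 : σ (c ζ) * σ ζ = 1 := by rw [← map_mul, key ζ hζn, map_one]
      have h2 := key (σ ζ) (by rw [← map_pow, hζn, map_one])
      calc σ (c ζ) = σ (c ζ) * (c (σ ζ) * σ ζ) := by rw [h2, mul_one]
        _ = (σ (c ζ) * σ ζ) * c (σ ζ) := by ring
        _ = c (σ ζ) := by rw [h1, one_mul])
    exact fun x => DFunLike.congr_fun this x

/-- Kronecker's theorem: the hypothesis on `c` gives absolute value 1 in every complex embedding, so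
`u` has finite order. For odd n the roots of unity of K are the powers of -ζ. -/
theorem eq_neg_pow_of_mul_conj_eq_one (hζ : IsPrimitiveRoot ζ n) (hn : Odd n)
    {c : 𝓞 K →+* 𝓞 K}
    (hc : ∀ (φ : 𝓞 K →+* ℂ) (x : 𝓞 K), φ (c x) = starRingEnd ℂ (φ x)) {u : 𝓞 K}
    (hu : u * c u = 1) : ∃ k : ℕ, u = (-ζ) ^ k := by
  have h1 : ∀ φ : K →+* ℂ, ‖φ (u : K)‖ = 1 := fun φ => by
    have h := congrArg (φ.comp (algebraMap (𝓞 K) K)) hu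
    rw [map_mul, hc, map_one, Complex.mul_conj, Complex.normSq_eq_norm_sq] at h
    have h' : ‖φ (u : K)‖ ^ 2 = 1 := by exact_mod_cast h
    exact (pow_eq_one_iff_of_nonneg (norm_nonneg _) two_ne_zero).mp h'
  obtain ⟨N, hN, h2⟩ := Embeddings.pow_eq_one_of_norm_eq_one K ℂ u.isIntegral_coe h1
  obtain ⟨k, hk⟩ := (hζ.map_of_injective (f := algebraMap (𝓞 K) K)
    RingOfIntegers.coe_injective).exists_neg_pow_of_isOfFinOrder hn
      (isOfFinOrder_iff_pow_eq_one.mpr ⟨N, hN, h2⟩)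
  refine ⟨k, RingOfIntegers.ext (hk.trans ?_)⟩
  rw [← map_neg]
  exact (map_pow (algebraMap (𝓞 K) K) (-ζ) k).symm

/-- Reduction after σ and Frobenius after reduction are ring homomorphisms into the residue ring
that agree at ζ, which generates. -/
theorem ringHom_sub_pow_mem (hζ : IsPrimitiveRoot ζ n) {p : ℕ} [hp : Fact p.Prime]
    {P : Ideal (𝓞 K)} [P.IsPrime] (hP : (p : 𝓞 K) ∈ P) {σ : 𝓞 K →+* 𝓞 K} (hσ : σ ζ = ζ ^ p)
    (x : 𝓞 K) : σ x - x ^ p ∈ P := by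
  have : CharP (𝓞 K ⧸ P) p := by
    refine (CharP.charP_iff_prime_eq_zero hp.out).mpr ?_
    rw [← map_natCast (Ideal.Quotient.mk P)]
    exact Ideal.Quotient.eq_zero_iff_mem.mpr hP
  have h : (Ideal.Quotient.mk P).comp σ = (frobenius (𝓞 K ⧸ P) p).comp (Ideal.Quotient.mk P) :=
    ringHom_ext_of_primitiveRoot hζ (by simp [hσ, frobenius_def])
  have hx := DFunLike.congr_fun h x
  rw [← Ideal.Quotient.eq, map_pow]
  simpa [frobenius_def] using hx

/-- σ induces Frobenius modulo each prime P above p, so it maps P into itself; multiplicativity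
extends this to products of such primes. -/
theorem map_le_self_of_dvd_prime_pow (hζ : IsPrimitiveRoot ζ n) {p : ℕ} [hp : Fact p.Prime]
    {σ : 𝓞 K →+* 𝓞 K} (hσ : σ ζ = ζ ^ p) {N : ℕ} (I : Ideal (𝓞 K))
    (hI : I ∣ Ideal.span {(p : 𝓞 K)} ^ N) : I.map σ ≤ I := by
  have hp0 : Ideal.span {(p : 𝓞 K)} ^ N ≠ 0 := by
    refine pow_ne_zero _ ?_
    rw [Ne, Ideal.zero_eq_bot, Ideal.span_singleton_eq_bot]
    exact_mod_cast hp.out.ne_zero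
  induction I using UniqueFactorizationMonoid.induction_on_prime with
  | h₁ => exact absurd (zero_dvd_iff.mp hI) hp0
  | h₂ I hI' =>
    rw [Ideal.isUnit_iff.mp hI']
    exact le_top
  | h₃ J P hJ hP ih =>
    rw [Ideal.map_mul]
    refine Ideal.mul_mono ?_ (ih ((Dvd.intro_left _ rfl).trans hI))
    have hPp : P.IsPrime := Ideal.isPrime_of_prime hP
    have hPmem : (p : 𝓞 K) ∈ P := by
      have h := hP.dvd_of_dvd_pow ((Dvd.intro _ rfl).trans hI)
      rwa [Ideal.dvd_span_singleton] at h
    rw [Ideal.map_le_iff_le_comap]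
    intro x hx
    have h := P.add_mem (ringHom_sub_pow_mem hζ hPmem hσ x) (P.pow_mem_of_mem hx p hp.out.pos)
    rwa [sub_add_cancel] at h

theorem exists_isMaximal_natCast_mem (K : Type*) [Field K] [NumberField K] {p : ℕ}
    (hp : p.Prime) : ∃ P : Ideal (𝓞 K), P.IsMaximal ∧ (p : 𝓞 K) ∈ P := by
  have hu : ¬ IsUnit (p : 𝓞 K) := by
    intro h
    have h' := (h.map (Algebra.norm ℤ))
    rw [show (p : 𝓞 K) = algebraMap ℤ (𝓞 K) p by simp, Algebra.norm_algebraMap,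
      Int.isUnit_iff_natAbs_eq, Int.natAbs_pow, Int.natAbs_natCast] at h'
    exact hp.one_lt.ne' ((pow_eq_one_iff_of_nonneg p.zero_le
      (Module.finrank_pos (R := ℤ) (M := 𝓞 K)).ne').mp h')
  obtain ⟨P, hP, hle⟩ := Ideal.exists_le_maximal _ (mt Ideal.span_singleton_eq_top.mp hu)
  exact ⟨P, hP, hle (Ideal.mem_span_singleton_self _)⟩

end CyclotomicIntegers

/-! ### Integer counting arguments modulo 11 -/

section Counting

/-- For u ≠ 0 only t = 0 (so p ≥ u) and t = -1 (so q ≥ 11 - u) are possible. The two products encode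
both cases linearly in t, so that they can be summed over an orbit. -/
theorem residue_bounds {p q t u : ℤ} (hp : 0 ≤ p) (hq : 0 ≤ q) (hp' : p ≤ 11) (hq' : q ≤ 4)
    (hu : 0 ≤ u) (hu' : u ≤ 10) (h : p - q = u + 11 * t) :
    (u = 0 ∧ 0 ≤ t ∧ 11 * t ≤ p) ∨
      (1 ≤ u ∧ -1 ≤ t ∧ t ≤ 0 ∧ u * (1 + t) ≤ p ∧ (u - 11) * t ≤ q) := by
  rcases hu.eq_or_lt with rfl | hu
  · omega
  · have ht : t = 0 ∨ t = -1 := by omega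
    rcases ht with rfl | rfl <;> omega

/-- Summing `residue_bounds` over the five classes of an orbit bounds P and Q below in terms of the
common residue u and T = ∑ tᵢ, while P - Q = 5u + 11T. With P ≤ 11 and Q ≤ 4 only u = 0, 1, 2, 10
survive. -/
theorem orbit_counts {p₁ p₂ p₃ p₄ p₅ q₁ q₂ q₃ q₄ q₅ : ℤ}
    (hp₁ : 0 ≤ p₁) (hp₂ : 0 ≤ p₂) (hp₃ : 0 ≤ p₃) (hp₄ : 0 ≤ p₄) (hp₅ : 0 ≤ p₅)
    (hq₁ : 0 ≤ q₁) (hq₂ : 0 ≤ q₂) (hq₃ : 0 ≤ q₃) (hq₄ : 0 ≤ q₄) (hq₅ : 0 ≤ q₅)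
    (hp : p₁ + p₂ + p₃ + p₄ + p₅ ≤ 11) (hq : q₁ + q₂ + q₃ + q₄ + q₅ ≤ 4)
    (h₂ : 11 ∣ (p₂ - q₂) - (p₁ - q₁)) (h₃ : 11 ∣ (p₃ - q₃) - (p₁ - q₁))
    (h₄ : 11 ∣ (p₄ - q₄) - (p₁ - q₁)) (h₅ : 11 ∣ (p₅ - q₅) - (p₁ - q₁)) :
    ((p₁ - q₁) % 11 = 0 ∧
      (p₁ + p₂ + p₃ + p₄ + p₅ = q₁ + q₂ + q₃ + q₄ + q₅ ∨
        p₁ + p₂ + p₃ + p₄ + p₅ = 11 ∧ q₁ + q₂ + q₃ + q₄ + q₅ = 0) ∧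
      (p₁ + q₁ = 0 ∨ p₂ + q₂ = 0 ∨ p₃ + q₃ = 0 ∨ p₄ + q₄ = 0 ∨ p₅ + q₅ = 0)) ∨
    ((p₁ - q₁) % 11 = 1 ∧ p₁ + p₂ + p₃ + p₄ + p₅ = 5 + (q₁ + q₂ + q₃ + q₄ + q₅)) ∨
    ((p₁ - q₁) % 11 = 2 ∧ p₁ + p₂ + p₃ + p₄ + p₅ = 10 + (q₁ + q₂ + q₃ + q₄ + q₅)) ∨
    ((p₁ - q₁) % 11 = 10 ∧ p₁ + p₂ + p₃ + p₄ + p₅ = 10 ∧ q₁ + q₂ + q₃ + q₄ + q₅ = 4) := by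
  obtain ⟨u, hu⟩ : ∃ u, u = (p₁ - q₁) % 11 := ⟨_, rfl⟩
  have hu0 : 0 ≤ u := by omega
  have hu1 : u ≤ 10 := by omega
  obtain ⟨t₁, e₁⟩ : ∃ t, p₁ - q₁ = u + 11 * t := ⟨(p₁ - q₁) / 11, by omega⟩
  obtain ⟨t₂, e₂⟩ : ∃ t, p₂ - q₂ = u + 11 * t := ⟨(p₂ - q₂) / 11, by omega⟩
  obtain ⟨t₃, e₃⟩ : ∃ t, p₃ - q₃ = u + 11 * t := ⟨(p₃ - q₃) / 11, by omega⟩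
  obtain ⟨t₄, e₄⟩ : ∃ t, p₄ - q₄ = u + 11 * t := ⟨(p₄ - q₄) / 11, by omega⟩
  obtain ⟨t₅, e₅⟩ : ∃ t, p₅ - q₅ = u + 11 * t := ⟨(p₅ - q₅) / 11, by omega⟩
  have b₁ := residue_bounds hp₁ hq₁ (by omega) (by omega) hu0 hu1 e₁
  have b₂ := residue_bounds hp₂ hq₂ (by omega) (by omega) hu0 hu1 e₂
  have b₃ := residue_bounds hp₃ hq₃ (by omega) (by omega) hu0 hu1 e₃
  have b₄ := residue_bounds hp₄ hq₄ (by omega) (by omega) hu0 hu1 e₄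
  have b₅ := residue_bounds hp₅ hq₅ (by omega) (by omega) hu0 hu1 e₅
  rw [← hu]
  clear h₂ h₃ h₄ h₅ hu
  obtain ⟨P, hP⟩ : ∃ P, P = p₁ + p₂ + p₃ + p₄ + p₅ := ⟨_, rfl⟩
  obtain ⟨Q, hQ⟩ : ∃ Q, Q = q₁ + q₂ + q₃ + q₄ + q₅ := ⟨_, rfl⟩
  obtain ⟨T, hT⟩ : ∃ T, T = t₁ + t₂ + t₃ + t₄ + t₅ := ⟨_, rfl⟩
  have hPQ : P - Q = 5 * u + 11 * T := by rw [hP, hQ, hT]; linarith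
  have hQ0 : 0 ≤ Q := by rw [hQ]; linarith
  rw [← hP, ← hQ]
  rw [← hP] at hp
  rw [← hQ] at hq
  rcases hu0.eq_or_lt with rfl | hu0
  · obtain ⟨-, z₁, a₁⟩ := b₁.resolve_right (fun h => absurd h.1 (by norm_num))
    obtain ⟨-, z₂, a₂⟩ := b₂.resolve_right (fun h => absurd h.1 (by norm_num))
    obtain ⟨-, z₃, a₃⟩ := b₃.resolve_right (fun h => absurd h.1 (by norm_num))
    obtain ⟨-, z₄, a₄⟩ := b₄.resolve_right (fun h => absurd h.1 (by norm_num))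
    obtain ⟨-, z₅, a₅⟩ := b₅.resolve_right (fun h => absurd h.1 (by norm_num))
    clear b₁ b₂ b₃ b₄ b₅
    have hT0 : 0 ≤ T := by rw [hT]; linarith
    have hT' : T = 0 ∨ T = 1 := by clear * - hPQ hp hQ0 hT0; omega
    refine Or.inl ⟨rfl, ?_, ?_⟩
    · clear * - hT' hPQ hp hQ0
      omega
    -- If no class is empty, T = 0 forces qᵢ ≥ 1 in all five classes, against Q ≤ 4, and T = 1
    -- forces Q = 0 and every tᵢ ≥ 1.
    · by_contra hcon
      push Not at hcon
      obtain ⟨c₁, c₂, c₃, c₄, c₅⟩ := hcon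
      rcases hT' with h | h
      · have k₁ : t₁ = 0 := by linarith
        have k₂ : t₂ = 0 := by linarith
        have k₃ : t₃ = 0 := by linarith
        have k₄ : t₄ = 0 := by linarith
        have k₅ : t₅ = 0 := by linarith
        clear hT hP hp z₁ z₂ z₃ z₄ z₅ a₁ a₂ a₃ a₄ a₅ hPQ
        have : 1 ≤ q₁ := by clear * - e₁ k₁ c₁ hq₁ hp₁; omega
        have : 1 ≤ q₂ := by clear * - e₂ k₂ c₂ hq₂ hp₂; omega
        have : 1 ≤ q₃ := by clear * - e₃ k₃ c₃ hq₃ hp₃; omega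
        have : 1 ≤ q₄ := by clear * - e₄ k₄ c₄ hq₄ hp₄; omega
        have : 1 ≤ q₅ := by clear * - e₅ k₅ c₅ hq₅ hp₅; omega
        linarith
      · have hQ1 : Q = 0 := by clear * - h hPQ hp hQ0; omega
        have k₁ : q₁ = 0 := by linarith
        have k₂ : q₂ = 0 := by linarith
        have k₃ : q₃ = 0 := by linarith
        have k₄ : q₄ = 0 := by linarith
        have k₅ : q₅ = 0 := by linarith
        have : 1 ≤ t₁ := by clear * - e₁ k₁ c₁ hp₁; omega
        have : 1 ≤ t₂ := by clear * - e₂ k₂ c₂ hp₂; omega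
        have : 1 ≤ t₃ := by clear * - e₃ k₃ c₃ hp₃; omega
        have : 1 ≤ t₄ := by clear * - e₄ k₄ c₄ hp₄; omega
        have : 1 ≤ t₅ := by clear * - e₅ k₅ c₅ hp₅; omega
        linarith
  · obtain ⟨-, z₁, y₁, a₁, w₁⟩ := b₁.resolve_left (fun h => hu0.ne' h.1)
    obtain ⟨-, z₂, y₂, a₂, w₂⟩ := b₂.resolve_left (fun h => hu0.ne' h.1)
    obtain ⟨-, z₃, y₃, a₃, w₃⟩ := b₃.resolve_left (fun h => hu0.ne' h.1)
    obtain ⟨-, z₄, y₄, a₄, w₄⟩ := b₄.resolve_left (fun h => hu0.ne' h.1)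
    obtain ⟨-, z₅, y₅, a₅, w₅⟩ := b₅.resolve_left (fun h => hu0.ne' h.1)
    have hPT : u * (5 + T) ≤ P := by rw [hP, hT]; linarith
    have hQT : (u - 11) * T ≤ Q := by rw [hQ, hT]; linarith
    have hT0 : T ≤ 0 := by rw [hT]; linarith
    have hT5 : -5 ≤ T := by rw [hT]; linarith
    clear * - hPT hQT hPQ hT0 hT5 hp hq hu0 hu1
    interval_cases u <;> omega

theorem sq_emod_eleven (s : ℤ) :
    ((s % 11 = 0) ∧ s ^ 2 % 11 = 0) ∨ ((s % 11 = 1 ∨ s % 11 = 10) ∧ s ^ 2 % 11 = 1) ∨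
    ((s % 11 = 2 ∨ s % 11 = 9) ∧ s ^ 2 % 11 = 4) ∨ ((s % 11 = 3 ∨ s % 11 = 8) ∧ s ^ 2 % 11 = 9) ∨
    ((s % 11 = 4 ∨ s % 11 = 7) ∧ s ^ 2 % 11 = 5) ∨
    ((s % 11 = 5 ∨ s % 11 = 6) ∧ s ^ 2 % 11 = 3) := by
  have h0 := Int.emod_nonneg s (by norm_num : (11 : ℤ) ≠ 0)
  have h1 := Int.emod_lt_of_pos s (by norm_num : (0 : ℤ) < 11)
  rw [pow_two, Int.mul_emod]
  generalize s % 11 = r at *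
  interval_cases r <;> simp

/-- The sum of squares is 27 ≡ 5 mod 11; against the totals this excludes every pair of orbit
residues except (0, 0). `W₁` and `W₂` stand for the existence of an empty class in each orbit. -/
theorem combine_orbit_counts {p₀ q₀ P₁ Q₁ P₂ Q₂ x₁ x₂ : ℤ} {W₁ W₂ : Prop}
    (hp₀ : 0 ≤ p₀) (hq₀ : 0 ≤ q₀) (hP₁ : 0 ≤ P₁) (hQ₁ : 0 ≤ Q₁) (hP₂ : 0 ≤ P₂) (hQ₂ : 0 ≤ Q₂)
    (hp : p₀ + P₁ + P₂ = 7 + (q₀ + Q₁ + Q₂)) (hq : q₀ + Q₁ + Q₂ ≤ 4)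
    (hsq : ((p₀ - q₀) ^ 2 + 5 * x₁ ^ 2 + 5 * x₂ ^ 2) % 11 = 5)
    (o₁ : (x₁ % 11 = 0 ∧ (P₁ = Q₁ ∨ P₁ = 11 ∧ Q₁ = 0) ∧ W₁) ∨ (x₁ % 11 = 1 ∧ P₁ = 5 + Q₁) ∨
      (x₁ % 11 = 2 ∧ P₁ = 10 + Q₁) ∨ (x₁ % 11 = 10 ∧ P₁ = 10 ∧ Q₁ = 4))
    (o₂ : (x₂ % 11 = 0 ∧ (P₂ = Q₂ ∨ P₂ = 11 ∧ Q₂ = 0) ∧ W₂) ∨ (x₂ % 11 = 1 ∧ P₂ = 5 + Q₂) ∨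
      (x₂ % 11 = 2 ∧ P₂ = 10 + Q₂) ∨ (x₂ % 11 = 10 ∧ P₂ = 10 ∧ Q₂ = 4)) :
    W₁ ∧ W₂ ∧ (p₀ = 7 + q₀ ∧ q₀ ≤ 4 ∨ p₀ = 0 ∧ q₀ = 4) := by
  have s₀ := sq_emod_eleven (p₀ - q₀)
  have s₁ := sq_emod_eleven x₁
  have s₂ := sq_emod_eleven x₂
  generalize (p₀ - q₀) ^ 2 = A at *
  generalize x₁ ^ 2 = B at *
  generalize x₂ ^ 2 = C at *
  rcases o₁ with ⟨r₁, d₁, w₁⟩ | ⟨r₁, d₁⟩ | ⟨r₁, d₁, d₁'⟩ | ⟨r₁, d₁, d₁'⟩ <;>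
  rcases o₂ with ⟨r₂, d₂, w₂⟩ | ⟨r₂, d₂⟩ | ⟨r₂, d₂, d₂'⟩ | ⟨r₂, d₂, d₂'⟩
  · exact ⟨w₁, w₂, by clear s₀ s₁ s₂ hsq; omega⟩
  all_goals
    exfalso
    rw [r₁] at s₁
    rw [r₂] at s₂
    norm_num at s₁ s₂
    omega

/-- The two finite sets are the orbits of multiplication by 3 on nonzero residues: quadratic
residues and nonresidues. One empty class per orbit is enough for the descent, since σ carries
vanishing around the orbit. -/
theorem class_counts (p q : ZMod 11 → ℕ) (hpq : ∑ k, p k = 7 + ∑ k, q k) (hq : ∑ k, q k ≤ 4)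
    (h3 : ∀ k, (11 : ℤ) ∣ ((p (3 * k) : ℤ) - q (3 * k)) - (p k - q k))
    (hsq : (11 : ℤ) ∣ ∑ k, ((p k : ℤ) - q k) ^ 2 - 27) :
    (∃ k ∈ ({1, 3, 9, 5, 4} : Finset (ZMod 11)), p k = 0 ∧ q k = 0) ∧
    (∃ k ∈ ({2, 6, 7, 10, 8} : Finset (ZMod 11)), p k = 0 ∧ q k = 0) ∧
    (p 0 = 7 + q 0 ∧ q 0 ≤ 4 ∨ p 0 = 0 ∧ q 0 = 4) := by
  have hsum : ∀ f : ZMod 11 → ℤ, ∑ k, f k = f 0 + (f 1 + f 3 + f 9 + f 5 + f 4) +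
      (f 2 + f 6 + f 7 + f 10 + f 8) := fun f => by
    rw [show (Finset.univ : Finset (ZMod 11)) = {0, 1, 3, 9, 5, 4, 2, 6, 7, 10, 8} by decide]
    repeat rw [Finset.sum_insert (by decide)]
    rw [Finset.sum_singleton]
    ring
  zify at hpq hq
  rw [hsum, hsum] at hpq
  rw [hsum] at hq
  have d₁ := h3 1
  have d₂ := h3 3
  have d₃ := h3 9
  have d₄ := h3 5
  have g₁ := h3 2
  have g₂ := h3 6
  have g₃ := h3 7
  have g₄ := h3 10
  rw [show (3 * 1 : ZMod 11) = 3 by decide] at d₁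
  rw [show (3 * 3 : ZMod 11) = 9 by decide] at d₂
  rw [show (3 * 9 : ZMod 11) = 5 by decide] at d₃
  rw [show (3 * 5 : ZMod 11) = 4 by decide] at d₄
  rw [show (3 * 2 : ZMod 11) = 6 by decide] at g₁
  rw [show (3 * 6 : ZMod 11) = 7 by decide] at g₂
  rw [show (3 * 7 : ZMod 11) = 10 by decide] at g₃
  rw [show (3 * 10 : ZMod 11) = 8 by decide] at g₄
  have hsq' : (((p 0 : ℤ) - q 0) ^ 2 + 5 * ((p 1 : ℤ) - q 1) ^ 2 + 5 * ((p 2 : ℤ) - q 2) ^ 2)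
      % 11 = 5 := by
    have sq : ∀ {a b : ℤ}, 11 ∣ a - b → a ^ 2 ≡ b ^ 2 [ZMOD 11] := fun h =>
      ((Int.modEq_iff_dvd.mpr h).symm).pow 2
    have e₁ := sq d₁
    have e₂ := (sq d₂).trans e₁
    have e₃ := (sq d₃).trans e₂
    have e₄ := (sq d₄).trans e₃
    have f₁ := sq g₁
    have f₂ := (sq g₂).trans f₁
    have f₃ := (sq g₃).trans f₂
    have f₄ := (sq g₄).trans f₃
    rw [hsum] at hsq
    have h := ((((Int.ModEq.refl (n := 11) (((p 0 : ℤ) - q 0) ^ 2)).add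
      (((((Int.ModEq.refl (((p 1 : ℤ) - q 1) ^ 2)).add e₁).add e₂).add e₃).add e₄)).add
      (((((Int.ModEq.refl (((p 2 : ℤ) - q 2) ^ 2)).add f₁).add f₂).add f₃).add f₄))).symm.trans
      (Int.modEq_iff_dvd.mpr hsq).symm
    clear * - h
    unfold Int.ModEq at h
    ring_nf at h ⊢
    omega
  have hp0 : ∀ k, (0 : ℤ) ≤ p k := fun k => Int.natCast_nonneg (p k)
  have hq0 : ∀ k, (0 : ℤ) ≤ q k := fun k => Int.natCast_nonneg (q k)
  have o₁ := orbit_counts (hp0 1) (hp0 3) (hp0 9) (hp0 5) (hp0 4)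
    (hq0 1) (hq0 3) (hq0 9) (hq0 5) (hq0 4)
    (by linarith [hp0 0, hp0 2, hp0 6, hp0 7, hp0 10, hp0 8])
    (by linarith [hq0 0, hq0 2, hq0 6, hq0 7, hq0 10, hq0 8])
    d₁ (by simpa using d₂.add d₁) (by simpa using (d₃.add d₂).add d₁)
    (by simpa using ((d₄.add d₃).add d₂).add d₁)
  have o₂ := orbit_counts (hp0 2) (hp0 6) (hp0 7) (hp0 10) (hp0 8)
    (hq0 2) (hq0 6) (hq0 7) (hq0 10) (hq0 8)
    (by linarith [hp0 0, hp0 1, hp0 3, hp0 9, hp0 5, hp0 4])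
    (by linarith [hq0 0, hq0 1, hq0 3, hq0 9, hq0 5, hq0 4])
    g₁ (by simpa using g₂.add g₁) (by simpa using (g₃.add g₂).add g₁)
    (by simpa using ((g₄.add g₃).add g₂).add g₁)
  obtain ⟨w₁, w₂, h⟩ := combine_orbit_counts (hp0 0) (hq0 0)
    (by linarith [hp0 1, hp0 3, hp0 9, hp0 5, hp0 4])
    (by linarith [hq0 1, hq0 3, hq0 9, hq0 5, hq0 4])
    (by linarith [hp0 2, hp0 6, hp0 7, hp0 10, hp0 8])
    (by linarith [hq0 2, hq0 6, hq0 7, hq0 10, hq0 8]) (by linarith) (by linarith) hsq' o₁ o₂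
  have hw : ∀ k, (p k : ℤ) + q k = 0 → p k = 0 ∧ q k = 0 := fun k h => by
    clear * - h
    omega
  refine ⟨?_, ?_, by exact_mod_cast h⟩
  · rcases w₁ with h | h | h | h | h
    exacts [⟨_, by decide, hw _ h⟩, ⟨_, by decide, hw _ h⟩, ⟨_, by decide, hw _ h⟩,
      ⟨_, by decide, hw _ h⟩, ⟨_, by decide, hw _ h⟩]
  · rcases w₂ with h | h | h | h | h
    exacts [⟨_, by decide, hw _ h⟩, ⟨_, by decide, hw _ h⟩, ⟨_, by decide, hw _ h⟩,
      ⟨_, by decide, hw _ h⟩, ⟨_, by decide, hw _ h⟩]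

end Counting

/-! ### Linear independence of conjugates and eigencomponents -/

section Eigenvectors

variable {R : Type*} [CommRing R] [IsDomain R]

theorem coeff_eq_of_sum_mul_root_pow_eq_zero {p : ℕ} [hp : Fact p.Prime] {ω : R}
    (hω : IsPrimitiveRoot ω p) {a : ZMod p → R}
    (h : ∀ t, 0 < t → t < p → ∑ j, a j * (ω ^ t) ^ j.val = 0) (i j : ZMod p) : a i = a j := by
  classical
  -- Subtracting the constant `a (-1)` keeps the roots, as the powers of ω ^ t sum to 0, and kills
  -- the top coefficient, as `(-1).val = p - 1`. Then f has degree below p - 1 but p - 1 roots.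
  set f : Polynomial R := ∑ k : ZMod p, Polynomial.C (a k - a (-1)) * Polynomial.X ^ k.val with hf
  have hroot : ∀ t, 0 < t → t < p → f.eval (ω ^ t) = 0 := fun t h0 h1 => by
    have hg : ∑ k : ZMod p, (ω ^ t) ^ k.val = 0 := by
      have hz := (hω.pow_of_coprime t ((Nat.coprime_comm.mp
        ((Nat.Prime.coprime_iff_not_dvd hp.out).mpr (Nat.not_dvd_of_pos_of_lt h0 h1))))).geom_sum_eq_zero
          hp.out.one_lt
      rw [← hz]
      refine Finset.sum_bij (fun k _ => k.val) (fun k _ => Finset.mem_range.mpr k.val_lt)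
        (fun x _ y _ hxy => ZMod.val_injective p hxy)
        (fun n hn => ⟨n, Finset.mem_univ _, ZMod.val_cast_of_lt (Finset.mem_range.mp hn)⟩)
        (fun _ _ => rfl)
    simp only [hf, Polynomial.eval_finsetSum, Polynomial.eval_mul, Polynomial.eval_C,
      Polynomial.eval_pow, Polynomial.eval_X, sub_mul, Finset.sum_sub_distrib, h t h0 h1,
      ← Finset.mul_sum, hg, mul_zero, sub_zero]
  have hdeg : f.degree < (p - 1 : ℕ) := by
    refine (Polynomial.degree_sum_le _ _).trans_lt ((Finset.sup_lt_iff (WithBot.bot_lt_coe _)).mpr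
      fun k _ => ?_)
    by_cases hk : k = -1
    · rw [hk, sub_self, map_zero, zero_mul, Polynomial.degree_zero]
      exact WithBot.bot_lt_coe _
    · refine (Polynomial.degree_C_mul_X_pow_le _ _).trans_lt ?_
      have h1 := k.val_lt
      have h2 : k.val ≠ p - 1 := fun h3 => hk (by
        rw [← ZMod.natCast_zmod_val k, h3, Nat.cast_sub hp.out.one_le]; simp)
      exact_mod_cast (by omega : k.val < p - 1)
  have hf0 : f = 0 := by
    refine Polynomial.eq_zero_of_degree_lt_of_eval_finset_eq_zero
      ((Finset.Ico 1 p).image (fun t => ω ^ t)) ?_ ?_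
    · rw [Finset.card_image_of_injOn, Nat.card_Ico]
      · exact hdeg
      · intro x hx y hy hxy
        simp only [Finset.coe_Ico, Set.mem_Ico] at hx hy
        exact hω.pow_inj hx.2 hy.2 hxy
    · intro x hx
      obtain ⟨t, ht, rfl⟩ := Finset.mem_image.mp hx
      rw [Finset.mem_Ico] at ht
      exact hroot t ht.1 ht.2
  have hcoef : ∀ k, a k = a (-1) := fun k => by
    have h1 := congrArg (fun g => Polynomial.coeff g k.val) hf0
    simp only [hf, Polynomial.finsetSum_coeff, Polynomial.coeff_C_mul, Polynomial.coeff_X_pow,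
      Polynomial.coeff_zero, mul_ite, mul_one, mul_zero] at h1
    rw [Finset.sum_eq_single k (fun b _ hb => if_neg fun h => hb (ZMod.val_injective p h.symm))
      (fun h => absurd (Finset.mem_univ _) h), if_pos rfl, sub_eq_zero] at h1
    exact h1
  rw [hcoef i, hcoef j]

variable [CharZero R]

/-- Iterating τ gives ∑ ψ(tk) V k = 0 for all t; Fourier inversion on ℤ/N isolates N · V l. -/
theorem eq_zero_of_sum_eigenvectors_eq_zero {N : ℕ} [NeZero N] {ψ : AddChar (ZMod N) R}
    (hψ : ψ.IsPrimitive) {τ : R →+* R} (hτ : ∀ k, τ (ψ k) = ψ k) {V : ZMod N → R}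
    (hV : ∀ k, τ (V k) = ψ k * V k) (h : ∑ k, V k = 0) (l : ZMod N) : V l = 0 := by
  have h1 : ∀ (t : ℕ), ∑ k, ψ (t * k) * V k = 0 := fun t => by
    induction t with
    | zero => simpa using h
    | succ t ih =>
      have := congrArg τ ih
      rw [map_sum, map_zero] at this
      rw [← this]
      refine Finset.sum_congr rfl fun k _ => ?_
      rw [map_mul τ, hτ, hV, ← mul_assoc, ← AddChar.map_add_eq_mul]
      push_cast
      ring_nf
  have h2 : ∑ t : ZMod N, ψ (-(t * l)) * ∑ k, ψ (t * k) * V k = 0 :=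
    Finset.sum_eq_zero fun t _ => by
      have := h1 t.val
      rw [ZMod.natCast_zmod_val] at this
      rw [this, mul_zero]
  simp_rw [Finset.mul_sum] at h2
  rw [Finset.sum_comm] at h2
  have h3 : ∀ k, ∑ t : ZMod N, ψ (-(t * l)) * (ψ (t * k) * V k) =
      if k = l then (N : R) * V k else 0 := fun k => by
    have := AddChar.sum_mulShift (k - l) hψ
    simp_rw [← mul_assoc, ← Finset.sum_mul, ← AddChar.map_add_eq_mul]
    rw [show (∑ t : ZMod N, ψ (-(t * l) + t * k)) = ∑ t, ψ (t * (k - l)) from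
      Finset.sum_congr rfl fun t _ => by ring_nf, this]
    split_ifs with h4 h5 h5
    · rw [ZMod.card]
    · exact absurd (sub_eq_zero.mp h4) h5
    · exact absurd (sub_eq_zero.mpr h5) h4
    · simp
  rw [Finset.sum_congr rfl fun k _ => h3 k, Finset.sum_ite_eq' Finset.univ l,
    if_pos (Finset.mem_univ _)] at h2
  exact (mul_eq_zero.mp h2).resolve_left (Nat.cast_ne_zero.mpr (NeZero.ne N))

/-- A ring endomorphism that scales the character by a unit permutes the eigencomponents. -/
theorem map_eigencomponent {N : ℕ} [NeZero N] {ψ : AddChar (ZMod N) R}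
    (hψ : ψ.IsPrimitive) {τ σ : R →+* R} (hτ : ∀ k, τ (ψ k) = ψ k)
    (hτσ : ∀ x, τ (σ x) = σ (τ x)) (u : (ZMod N)ˣ) (hσ : ∀ k, σ (ψ k) = ψ (u * k))
    {V : ZMod N → R} (hV : ∀ k, τ (V k) = ψ k * V k) (h : σ (∑ k, V k) = ∑ k, V k)
    (k : ZMod N) : σ (V k) = V (u * k) := by
  have key := eq_zero_of_sum_eigenvectors_eq_zero hψ hτ
    (V := fun k => σ (V (↑u⁻¹ * k)) - V k) (fun k => by
      rw [map_sub, hτσ, hV, hV, map_mul, hσ, Units.mul_inv_cancel_left, mul_sub]) (by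
      rw [Finset.sum_sub_distrib, sub_eq_zero]
      rw [map_sum] at h
      rw [← h]
      exact Fintype.sum_equiv (Units.mulLeft u⁻¹) _ _ (fun k => rfl)) (u * k)
  simpa [sub_eq_zero] using key

/-- Expand the product: the terms V k · c(V (k - e)) with fixed e form the component of eigenvalue ψ
e. The integer d has only the component e = 0. -/
theorem sum_mul_conj_eigencomponents {N : ℕ} [NeZero N] {ψ : AddChar (ZMod N) R}
    (hψ : ψ.IsPrimitive) {τ c : R →+* R} (hτ : ∀ k, τ (ψ k) = ψ k)
    (hτc : ∀ x, τ (c x) = c (τ x)) (hc : ∀ k, c (ψ k) = ψ (-k))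
    {V : ZMod N → R} (hV : ∀ k, τ (V k) = ψ k * V k) {d : ℕ}
    (h : (∑ k, V k) * c (∑ k, V k) = d) : ∑ k, V k * c (V k) = d := by
  have key := eq_zero_of_sum_eigenvectors_eq_zero hψ hτ
    (V := fun e => ∑ k, V k * c (V (k - e)) - if e = 0 then (d : R) else 0) (fun e => by
      have h1 : ∀ k, τ (V k * c (V (k - e))) = ψ e * (V k * c (V (k - e))) := fun k => by
        rw [map_mul, hτc, hV, hV, map_mul, hc]
        calc ψ k * V k * (ψ (-(k - e)) * c (V (k - e)))
            = (ψ k * ψ (-(k - e))) * (V k * c (V (k - e))) := by ring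
          _ = _ := by rw [← AddChar.map_add_eq_mul]; ring_nf
      rw [map_sub, map_sum, Finset.sum_congr rfl fun k _ => h1 k, ← Finset.mul_sum, mul_sub]
      split_ifs with h0
      · simp [h0]
      · simp) (by
      rw [Finset.sum_sub_distrib, Finset.sum_ite_eq' Finset.univ, if_pos (Finset.mem_univ _),
        Finset.sum_comm, ← h, map_sum, Finset.sum_mul_sum, sub_eq_zero]
      refine Finset.sum_congr rfl fun k _ => ?_
      exact Fintype.sum_equiv (Equiv.subLeft k) _ _ (fun e => rfl)) 0
  simpa [sub_eq_zero] using key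

end Eigenvectors

/-! ### Sums of powers of a root of unity -/

section RootSums

/-- The sum of the powers of `z` with exponents in the multiset `A`. -/
def rootSum {R : Type*} [CommSemiring R] (z : R) (A : Multiset ℕ) : R :=
  (A.map fun a => z ^ a).sum

variable {R S : Type*} [CommSemiring R] [CommSemiring S]

@[simp]
theorem rootSum_zero (z : R) : rootSum z 0 = 0 := rfl

@[simp]
theorem rootSum_cons (z : R) (a : ℕ) (A : Multiset ℕ) :
    rootSum z (a ::ₘ A) = z ^ a + rootSum z A := by
  simp [rootSum]

@[simp]
theorem rootSum_one (A : Multiset ℕ) : rootSum (1 : R) A = (Multiset.card A : R) := by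
  simp [rootSum]

theorem map_rootSum (σ : R →+* S) (z : R) (A : Multiset ℕ) :
    σ (rootSum z A) = rootSum (σ z) A := by
  simp [rootSum, map_multiset_sum]

theorem sum_rootSum_filter {N : ℕ} [NeZero N] (z : R) (A : Multiset ℕ) :
    ∑ k : ZMod N, rootSum z (A.filter fun a : ℕ => (a : ZMod N) = k) = rootSum z A := by
  induction A using Multiset.induction_on with
  | empty => simp
  | cons a A ih =>
    rw [rootSum_cons, ← ih]
    have h : ∀ k : ZMod N, rootSum z ((a ::ₘ A).filter fun a : ℕ => (a : ZMod N) = k) =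
        (if (a : ZMod N) = k then z ^ a else 0) +
          rootSum z (A.filter fun a : ℕ => (a : ZMod N) = k) := fun k => by
      by_cases hk : (a : ZMod N) = k
      · simp [hk]
      · simp [hk]
    rw [Finset.sum_congr rfl fun k _ => h k, Finset.sum_add_distrib,
      Finset.sum_ite_eq Finset.univ, if_pos (Finset.mem_univ _)]

theorem sum_card_filter_natCast {N : ℕ} [NeZero N] (A : Multiset ℕ) :
    ∑ k : ZMod N, Multiset.card (A.filter fun a : ℕ => (a : ZMod N) = k) = Multiset.card A := by
  simpa using sum_rootSum_filter (N := N) (1 : ℕ) A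

theorem rootSum_map_div {N : ℕ} (z : R) {A : Multiset ℕ} (h : ∀ a ∈ A, N ∣ a) :
    rootSum (z ^ N) (A.map (· / N)) = rootSum z A := by
  simp only [rootSum, Multiset.map_map, Function.comp_def]
  refine congrArg _ (Multiset.map_congr rfl fun a ha => ?_)
  rw [← pow_mul, Nat.mul_div_cancel' (h a ha)]

theorem norm_rootSum_le {z : ℂ} (hz : ‖z‖ = 1) (A : Multiset ℕ) :
    ‖rootSum z A‖ ≤ Multiset.card A := by
  induction A using Multiset.induction_on with
  | empty => simp
  | cons a A ih =>
    rw [rootSum_cons, Multiset.card_cons]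
    refine (norm_add_le _ _).trans ?_
    rw [norm_pow, hz, one_pow]
    push_cast
    linarith

theorem map_rootSum_filter {N : ℕ} {R : Type*} [CommRing R] {ψ : AddChar (ZMod N) R}
    {τ : R →+* R} {z : R} (hτ : τ z = ψ 1 * z) (A : Multiset ℕ) (k : ZMod N) :
    τ (rootSum z (A.filter fun a : ℕ => (a : ZMod N) = k)) =
      ψ k * rootSum z (A.filter fun a : ℕ => (a : ZMod N) = k) := by
  rw [map_rootSum, hτ, rootSum, rootSum, ← Multiset.sum_map_mul_left]
  refine congrArg _ (Multiset.map_congr rfl fun a ha => ?_)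
  rw [mul_pow, ← (Multiset.mem_filter.mp ha).2, ← AddChar.map_nsmul_eq_pow, nsmul_one]

end RootSums

/-! ### Descent from conductor 11 ^ (r + 2) to 11 ^ (r + 1) -/

section Descent

universe u

/-- The ring endomorphisms of a ring of cyclotomic integers of conductor `n` that are used below:
`σ` raises roots of unity to the power `e`, and `c` is complex conjugation. -/
structure CyclotomicActions (R : Type*) [CommRing R] (n e : ℕ) (σ c : R →+* R) : Prop where
  map_root : ∀ w, w ^ n = 1 → σ w = w ^ e
  conj_mul : ∀ w, w ^ n = 1 → c w * w = 1
  exists_pow : ∀ a, a.Coprime n → ∃ τ : R →+* R, (∀ w, w ^ n = 1 → τ w = w ^ a) ∧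
    (∀ x, τ (c x) = c (τ x)) ∧ ∀ x, τ (σ x) = σ (τ x)
  exists_embedding : ∃ φ : R →+* ℂ, ∀ x, φ (c x) = starRingEnd ℂ (φ x)
  exists_maximal : ∀ p : ℕ, p.Prime → ∃ P : Ideal R, P.IsMaximal ∧ (p : R) ∈ P

variable {R : Type u} [CommRing R] [IsDomain R] [CharZero R] {n : ℕ} [NeZero n] {σ c : R →+* R}

-- At most four roots of unity have a sum of absolute value at most 4, and 16 < 27.
omit [IsDomain R] [CharZero R] in
theorem CyclotomicActions.neg_rootSum_mul_conj_ne {e : ℕ} (h : CyclotomicActions R n e σ c) {z : R}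
    (hz : z ^ n = 1) {B : Multiset ℕ} (hB : Multiset.card B ≤ 4) :
    -rootSum z B * c (-rootSum z B) ≠ 27 := by
  intro hX
  obtain ⟨φ, hφ⟩ := h.exists_embedding
  have h1 := congrArg φ hX
  rw [map_mul, hφ, Complex.mul_conj, map_neg, Complex.normSq_neg, Complex.normSq_eq_norm_sq,
    map_ofNat, map_rootSum] at h1
  have h2 : ‖rootSum (φ z) B‖ ^ 2 = 27 := by exact_mod_cast h1
  have h3 := norm_rootSum_le (z := φ z) (Complex.norm_eq_one_of_pow_eq_one
    (by rw [← map_pow, hz, map_one]) (NeZero.ne n)) B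
  have h4 : (Multiset.card B : ℝ) ≤ 4 := by exact_mod_cast hB
  nlinarith [norm_nonneg (rootSum (φ z) B)]

/-- Reduction modulo a prime above `p` sends `p`-power roots of unity to `1`. -/
theorem CyclotomicActions.exists_reduction {R : Type u} [CommRing R] {n e : ℕ} {σ c : R →+* R}
    (h : CyclotomicActions R n e σ c) (p : ℕ) [hp : Fact p.Prime] : ∃ (F : Type u) (_ : Field F) (_ : CharP F p) (π : R →+* F),
      ∀ (z : R) (k : ℕ), z ^ p ^ k = 1 → π z = 1 := by
  obtain ⟨P, hP, hpP⟩ := h.exists_maximal p hp.out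
  let := Ideal.Quotient.field P
  have hF : CharP (R ⧸ P) p := by
    refine (CharP.charP_iff_prime_eq_zero hp.out).mpr ?_
    rw [← map_natCast (Ideal.Quotient.mk P)]
    exact Ideal.Quotient.eq_zero_iff_mem.mpr hpP
  refine ⟨R ⧸ P, inferInstance, hF, Ideal.Quotient.mk P, fun z k hz => ?_⟩
  have h1 : (Ideal.Quotient.mk P z - 1) ^ p ^ k = 0 := by
    rw [sub_pow_char_pow, ← map_pow, hz, map_one, one_pow, sub_self]
  exact sub_eq_zero.mp (pow_eq_zero_iff (pow_ne_zero _ hp.out.ne_zero) |>.mp h1)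

theorem eq_three_pow_mul : ∀ i ∈ ({1, 3, 9, 5, 4} : Finset (ZMod 11)), ∀ j ∈ ({2, 6, 7, 10, 8} :
    Finset (ZMod 11)), ∀ k : ZMod 11, k ≠ 0 → k = i ∨ k = 3 * i ∨ k = 3 * (3 * i) ∨
      k = 3 * (3 * (3 * i)) ∨ k = 3 * (3 * (3 * (3 * i))) ∨ k = j ∨ k = 3 * j ∨
      k = 3 * (3 * j) ∨ k = 3 * (3 * (3 * j)) ∨ k = 3 * (3 * (3 * (3 * j))) := by decide

/-- V k collects the terms with exponent ≡ k mod 11. These are eigenvectors of an automorphism τ : z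
↦ ωz with ω of order 11, so σ permutes them by k ↦ 3k and their norms add up to 27. Reduction at 11
turns both facts into the hypotheses of `class_counts`. -/
theorem CyclotomicActions.descent_step {N r : ℕ} [NeZero (5 * 11 ^ N)]
    (h : CyclotomicActions R (5 * 11 ^ N) 3 σ c)
    (hr : r + 2 ≤ N) {z : R} (hz : IsPrimitiveRoot z (11 ^ (r + 2))) {A B : Multiset ℕ}
    (hAB : Multiset.card A = 7 + Multiset.card B) (hB : Multiset.card B ≤ 4)
    (hX : (rootSum z A - rootSum z B) * c (rootSum z A - rootSum z B) = 27)
    (hσX : σ (rootSum z A - rootSum z B) = rootSum z A - rootSum z B) :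
    ∃ A' B' : Multiset ℕ, Multiset.card A' = 7 + Multiset.card B' ∧ Multiset.card B' ≤ 4 ∧
      rootSum z A - rootSum z B = rootSum (z ^ 11) A' - rootSum (z ^ 11) B' := by
  have hroot : ∀ w : R, w ^ 11 ^ (r + 2) = 1 → w ^ (5 * 11 ^ N) = 1 := fun w hw => by
    obtain ⟨d, hd⟩ := (pow_dvd_pow 11 hr).trans (Dvd.intro_left 5 rfl)
    rw [hd, pow_mul, hw, one_pow]
  have hroot11 : ∀ w : R, w ^ 11 = 1 → w ^ (5 * 11 ^ N) = 1 := fun w hw => hroot w (by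
    rw [pow_succ', pow_mul, hw, one_pow])
  set ω : R := (z ^ 11 ^ (r + 1)) ^ 5 with hω
  have hωp : IsPrimitiveRoot ω 11 :=
    (hz.pow (pow_pos (by norm_num) _) (pow_succ 11 (r + 1))).pow_of_coprime 5 (by norm_num)
  set ψ : AddChar (ZMod 11) R := AddChar.zmodChar 11 hωp.pow_eq_one with hψ
  have hψp : ψ.IsPrimitive := AddChar.zmodChar_primitive_of_primitive_root 11 hωp
  have hψ1 : ψ 1 = ω := by
    have := AddChar.zmodChar_apply' hωp.pow_eq_one 1
    rwa [Nat.cast_one, pow_one] at this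
  have hψ11 : ∀ k, ψ k ^ 11 = 1 := fun k => by
    rw [← AddChar.map_nsmul_eq_pow]
    have : (11 : ℕ) • k = 0 := by
      rw [nsmul_eq_mul, show ((11 : ℕ) : ZMod 11) = 0 from rfl, zero_mul]
    rw [this, AddChar.map_zero_eq_one]
  -- The factor 5 makes the exponent prime to 5; it is also why ω carries a fifth power.
  obtain ⟨τ, hτ, hτc, hτσ⟩ := h.exists_pow (1 + 5 * 11 ^ (r + 1)) (by
    refine Nat.Coprime.mul_right ?_ (Nat.Coprime.pow_right _ ?_)
    · simp
    · rw [pow_succ, ← mul_assoc]; simp)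
  have hτψ : ∀ k, τ (ψ k) = ψ k := fun k => by
    rw [hτ _ (hroot11 _ (hψ11 k)), pow_add, pow_one, pow_succ, ← mul_assoc, mul_comm (5 * 11 ^ r),
      pow_mul, hψ11, one_pow, mul_one]
  have hτz : τ z = ψ 1 * z := by
    rw [hτ _ (hroot _ hz.pow_eq_one), hψ1, hω, ← pow_mul, pow_add, pow_one, mul_comm,
      mul_comm (11 ^ (r + 1))]
  set V : ZMod 11 → R := fun k => rootSum z (A.filter fun a : ℕ => (a : ZMod 11) = k) -
    rootSum z (B.filter fun a : ℕ => (a : ZMod 11) = k) with hV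
  have hVsum : ∑ k, V k = rootSum z A - rootSum z B := by
    rw [hV, Finset.sum_sub_distrib, sum_rootSum_filter, sum_rootSum_filter]
  have hτV : ∀ k, τ (V k) = ψ k * V k := fun k => by
    rw [hV]
    simp only [map_sub, map_rootSum_filter hτz, mul_sub]
  have hσV : ∀ k, σ (V k) = V (3 * k) := by
    refine map_eigencomponent hψp hτψ hτσ (ZMod.unitOfCoprime 3 (by norm_num) : (ZMod 11)ˣ)
      (fun k => ?_) hτV (by rw [hVsum, hσX])
    rw [h.map_root _ (hroot11 _ (hψ11 k)), ← AddChar.map_nsmul_eq_pow]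
    simp
  have hcV : ∑ k, V k * c (V k) = (27 : ℕ) := by
    refine sum_mul_conj_eigencomponents hψp hτψ hτc (fun k => ?_) hτV (by
      rw [hVsum, hX]; norm_num)
    have h1 := h.conj_mul _ (hroot11 _ (hψ11 k))
    have h2 : ψ (-k) * ψ k = 1 := by
      rw [← AddChar.map_add_eq_mul, neg_add_cancel, AddChar.map_zero_eq_one]
    calc c (ψ k) = c (ψ k) * (ψ (-k) * ψ k) := by rw [h2, mul_one]
      _ = (c (ψ k) * ψ k) * ψ (-k) := by ring
      _ = ψ (-k) := by rw [h1, one_mul]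
  have : Fact (Nat.Prime 11) := ⟨by norm_num⟩
  obtain ⟨F, _, hF, π, hπ⟩ := h.exists_reduction 11
  have hz1 : π z = 1 := hπ z _ hz.pow_eq_one
  set p : ZMod 11 → ℕ := fun k => Multiset.card (A.filter fun a : ℕ => (a : ZMod 11) = k) with hp
  set q : ZMod 11 → ℕ := fun k => Multiset.card (B.filter fun a : ℕ => (a : ZMod 11) = k) with hq
  -- Needed for f = π, π ∘ σ and π ∘ c, all of which send z to 1.
  have hπV : ∀ f : R →+* F, f z = 1 → ∀ k, f (V k) = ((p k : ℤ) - q k : ℤ) := fun f hf k => by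
    rw [hV]
    simp only [map_sub, map_rootSum, hf, rootSum_one]
    push_cast
    rfl
  have hdvdF : ∀ a : ℤ, (a : F) = 0 → (11 : ℤ) ∣ a := fun a ha => by
    exact_mod_cast (CharP.intCast_eq_zero_iff F 11 a).mp ha
  have hcz : π (c z) = 1 := by
    have := congrArg π (h.conj_mul z (hroot _ hz.pow_eq_one))
    rwa [map_mul, hz1, mul_one, map_one] at this
  have hσz : π (σ z) = 1 := by rw [h.map_root z (hroot _ hz.pow_eq_one), map_pow, hz1, one_pow]
  obtain ⟨⟨i, hi, hi0⟩, ⟨j, hj, hj0⟩, h0⟩ := class_counts p q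
    (by rw [hp, hq, sum_card_filter_natCast, sum_card_filter_natCast, hAB])
    (by rw [hq, sum_card_filter_natCast]; exact hB)
    (fun k => by
      refine hdvdF _ ?_
      rw [Int.cast_sub, ← hπV π hz1, ← hσV, ← hπV (π.comp σ) hσz]
      simp)
    (by
      have h1 := congrArg π hcV
      rw [map_sum] at h1
      have h2 : ∀ k, π (V k * c (V k)) = ((((p k : ℤ) - q k) ^ 2 : ℤ) : F) := fun k => by
        have := hπV (π.comp c) hcz k
        rw [RingHom.comp_apply] at this
        rw [map_mul, hπV π hz1, this]
        push_cast
        ring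
      rw [Finset.sum_congr rfl fun k _ => h2 k, ← Int.cast_sum, map_natCast] at h1
      refine hdvdF _ ?_
      rw [Int.cast_sub, h1]
      simp)
  have hzero : ∀ k, p k = 0 ∧ q k = 0 → V k = 0 := fun k hk => by
    rw [hV]
    simp only
    rw [Multiset.card_eq_zero.mp hk.1, Multiset.card_eq_zero.mp hk.2]
    simp
  have hV3 : ∀ k, V k = 0 → V (3 * k) = 0 := fun k hk => by rw [← hσV, hk, map_zero]
  have hV0 : ∀ k, k ≠ 0 → V k = 0 := by
    have hvi := hzero i hi0
    have hvj := hzero j hj0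
    have hvi1 := hV3 _ hvi
    have hvi2 := hV3 _ hvi1
    have hvi3 := hV3 _ hvi2
    have hvi4 := hV3 _ hvi3
    have hvj1 := hV3 _ hvj
    have hvj2 := hV3 _ hvj1
    have hvj3 := hV3 _ hvj2
    have hvj4 := hV3 _ hvj3
    intro k hk
    rcases eq_three_pow_mul i hi j hj k hk with h | h | h | h | h | h | h | h | h | h <;> rw [h] <;> assumption
  have hX0 : rootSum z A - rootSum z B = V 0 := by
    rw [← hVsum]
    exact Finset.sum_eq_single 0 (fun k _ hk => hV0 k hk) (fun h => absurd (Finset.mem_univ _) h)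
  rcases h0 with ⟨h0, h0'⟩ | ⟨h0, h0'⟩
  · have hdvd : ∀ C : Multiset ℕ, ∀ a ∈ C.filter fun a : ℕ => (a : ZMod 11) = 0, 11 ∣ a :=
      fun C a ha => (ZMod.natCast_eq_zero_iff a 11).mp (Multiset.mem_filter.mp ha).2
    refine ⟨(A.filter fun a : ℕ => (a : ZMod 11) = 0).map (· / 11),
      (B.filter fun a : ℕ => (a : ZMod 11) = 0).map (· / 11), ?_, ?_, ?_⟩
    · rw [Multiset.card_map, Multiset.card_map]; exact h0
    · rw [Multiset.card_map]; exact h0'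
    · rw [hX0, rootSum_map_div z (hdvd A), rootSum_map_div z (hdvd B)]
  · exfalso
    have hVB : V 0 = -rootSum z (B.filter fun a : ℕ => (a : ZMod 11) = 0) := by
      rw [hV]
      simp only
      rw [Multiset.card_eq_zero.mp h0, rootSum_zero, zero_sub]
    rw [hX0, hVB] at hX
    exact h.neg_rootSum_mul_conj_ne (hroot _ hz.pow_eq_one) h0'.le hX

end Descent

/-! ### Quadratic Gauss periods modulo 11 -/

section QuadraticPeriods

variable {R : Type*} [CommRing R]

/-- The Gauss period of the quadratic residues modulo `11`. -/
def gaussPeriod (ω : R) : R := ω + ω ^ 3 + ω ^ 4 + ω ^ 5 + ω ^ 9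

/-- The Gauss period of the quadratic nonresidues modulo `11`. -/
def gaussPeriod' (ω : R) : R := ω ^ 2 + ω ^ 6 + ω ^ 7 + ω ^ 8 + ω ^ 10

variable {ω : R}

/-- Conjugation swaps the two periods because -1 is a nonresidue mod 11. -/
theorem map_gaussPeriod {c : R →+* R} (hω : ω ^ 11 = 1) (hc : c ω = ω ^ 10) :
    c (gaussPeriod ω) = gaussPeriod' ω := by
  have h : ∀ k, ω ^ (k + 11) = ω ^ k := fun k => by rw [pow_add, hω, mul_one]
  unfold gaussPeriod gaussPeriod'
  simp only [map_add, map_pow, hc, ← pow_mul]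
  rw [show ω ^ (10 * 3) = ω ^ 8 from (h 19).trans (h 8),
    show ω ^ (10 * 4) = ω ^ 7 from (h 29).trans ((h 18).trans (h 7)),
    show ω ^ (10 * 5) = ω ^ 6 from (h 39).trans ((h 28).trans ((h 17).trans (h 6))),
    show ω ^ (10 * 9) = ω ^ 2 from (h 79).trans ((h 68).trans ((h 57).trans ((h 46).trans
      ((h 35).trans ((h 24).trans ((h 13).trans (h 2)))))))]
  ring

theorem map_gaussPeriod' {c : R →+* R} (hω : ω ^ 11 = 1) (hc : c ω = ω ^ 10) :
    c (gaussPeriod' ω) = gaussPeriod ω := by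
  have h : ∀ k, ω ^ (k + 11) = ω ^ k := fun k => by rw [pow_add, hω, mul_one]
  unfold gaussPeriod gaussPeriod'
  simp only [map_add, map_pow, hc, ← pow_mul]
  rw [show ω ^ (10 * 2) = ω ^ 9 from h 9,
    show ω ^ (10 * 6) = ω ^ 5 from (h 49).trans ((h 38).trans ((h 27).trans ((h 16).trans (h 5)))),
    show ω ^ (10 * 7) = ω ^ 4 from (h 59).trans ((h 48).trans ((h 37).trans ((h 26).trans
      ((h 15).trans (h 4))))),
    show ω ^ (10 * 8) = ω ^ 3 from (h 69).trans ((h 58).trans ((h 47).trans ((h 36).trans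
      ((h 25).trans ((h 14).trans (h 3)))))),
    show ω ^ (10 * 10) = ω from (h 89).trans ((h 78).trans ((h 67).trans ((h 56).trans
      ((h 45).trans ((h 34).trans ((h 23).trans ((h 12).trans ((h 1).trans (pow_one ω)))))))))]
  ring

variable [IsDomain R]

theorem geom_sum_eleven (hω : IsPrimitiveRoot ω 11) :
    1 + ω + ω ^ 2 + ω ^ 3 + ω ^ 4 + ω ^ 5 + ω ^ 6 + ω ^ 7 + ω ^ 8 + ω ^ 9 + ω ^ 10 = 0 := by
  have h := hω.geom_sum_eq_zero (by norm_num)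
  simpa [Finset.sum_range_succ] using h

theorem gaussPeriod_add (hω : IsPrimitiveRoot ω 11) : gaussPeriod ω + gaussPeriod' ω = -1 := by
  unfold gaussPeriod gaussPeriod'
  linear_combination geom_sum_eleven hω

theorem gaussPeriod_mul (hω : IsPrimitiveRoot ω 11) : gaussPeriod ω * gaussPeriod' ω = 3 := by
  unfold gaussPeriod gaussPeriod'
  -- The factor is the quotient of the polynomial difference by the eleventh cyclotomic polynomial.
  linear_combination (-3 + 3 * ω + ω ^ 3 - ω ^ 4 + ω ^ 5 + ω ^ 7 - ω ^ 8 + ω ^ 9) * geom_sum_eleven hω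

end QuadraticPeriods

/-! ### Base case: conductor 11 -/

section Base

theorem sum_zmod_eleven {M : Type*} [AddCommMonoid M] (f : ZMod 11 → M) :
    ∑ k, f k = f 0 + f 1 + f 2 + f 3 + f 4 + f 5 + f 6 + f 7 + f 8 + f 9 + f 10 := by
  rw [show (Finset.univ : Finset (ZMod 11)) = {0, 1, 2, 3, 4, 5, 6, 7, 8, 9, 10} by decide]
  repeat rw [Finset.sum_insert (by decide)]
  rw [Finset.sum_singleton]
  simp only [add_assoc]

variable {R : Type*} [CommRing R]

theorem rootSum_eq_sum_card {N : ℕ} [NeZero N] {w : R} (hw : w ^ N = 1) (A : Multiset ℕ) :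
    rootSum w A = ∑ k : ZMod N,
      (Multiset.card (A.filter fun a : ℕ => (a : ZMod N) = k) : R) * w ^ k.val := by
  rw [← sum_rootSum_filter (N := N)]
  refine Finset.sum_congr rfl fun k _ => ?_
  rw [rootSum, ← nsmul_eq_mul, ← Multiset.sum_replicate, ← Multiset.map_const']
  refine congrArg _ (Multiset.map_congr rfl fun a ha => ?_)
  rw [← (Multiset.mem_filter.mp ha).2, ZMod.val_natCast, ← pow_eq_pow_mod a hw]

theorem exists_coprime_five_mul_eleven_pow (N : ℕ) {t : ℕ} (ht0 : 0 < t) (ht1 : t < 11) :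
    ∃ s : ℕ, s.Coprime (5 * 11 ^ N) ∧ s % 11 = t := by
  have : ∃ s : ℕ, s.Coprime 5 ∧ s.Coprime 11 ∧ s % 11 = t := by
    by_cases h5 : t % 5 = 0
    · exact ⟨t + 11, by interval_cases t <;> first | decide | omega,
        by interval_cases t <;> decide, by omega⟩
    · exact ⟨t, by interval_cases t <;> first | decide | omega,
        by interval_cases t <;> decide, by omega⟩
  obtain ⟨s, h1, h2, h3⟩ := this
  exact ⟨s, h1.mul_right (h2.pow_right _), h3⟩

variable [IsDomain R] [CharZero R] {σ c : R →+* R}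

/-- Invariance under σ makes the coefficients constant on the two orbits, so X = y₀ + y₁η + y₂η'
with periods η, η'. The counts leave six pairs (y₁, y₂); |X|² = 27 selects (2, 0) and (0, 2), that
is X = -3 + 2η or -3 + 2η'. -/
theorem CyclotomicActions.conductor_eleven {N : ℕ} [NeZero (5 * 11 ^ (N + 1))]
    (h : CyclotomicActions R (5 * 11 ^ (N + 1)) 3 σ c) {w : R}
    (hw : IsPrimitiveRoot w 11) {A B : Multiset ℕ}
    (hAB : Multiset.card A = 7 + Multiset.card B) (hB : Multiset.card B ≤ 4)
    (hX : (rootSum w A - rootSum w B) * c (rootSum w A - rootSum w B) = 27)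
    (hσX : σ (rootSum w A - rootSum w B) = rootSum w A - rootSum w B) :
    (rootSum w A - rootSum w B) ^ 2 + 8 * (rootSum w A - rootSum w B) + 27 = 0 := by
  have : Fact (Nat.Prime 11) := ⟨by norm_num⟩
  have hroot : ∀ w : R, w ^ 11 = 1 → w ^ (5 * 11 ^ (N + 1)) = 1 := fun w hw => by
    rw [pow_succ, ← mul_assoc, mul_comm, pow_mul, hw, one_pow]
  set p : ZMod 11 → ℕ := fun k => Multiset.card (A.filter fun a : ℕ => (a : ZMod 11) = k) with hp
  set q : ZMod 11 → ℕ := fun k => Multiset.card (B.filter fun a : ℕ => (a : ZMod 11) = k) with hq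
  set y : ZMod 11 → ℤ := fun k => (p k : ℤ) - q k with hy
  have hXy : ∀ v : R, v ^ 11 = 1 → rootSum v A - rootSum v B = ∑ k, (y k : R) * v ^ k.val := by
    intro v hv
    rw [rootSum_eq_sum_card hv, rootSum_eq_sum_card hv, ← Finset.sum_sub_distrib]
    refine Finset.sum_congr rfl fun k _ => ?_
    rw [hy]
    push_cast
    ring
  have hσw : σ w = w ^ 3 := h.map_root w (hroot w hw.pow_eq_one)
  -- The substitution uses 4 = 3⁻¹ mod 11.
  have hshift : ∀ v : R, v ^ 11 = 1 → ∑ k, (y k : R) * (v ^ 3) ^ k.val =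
      ∑ k, (y (4 * k) : R) * v ^ k.val := by
    intro v hv
    refine (Fintype.sum_equiv (Units.mulLeft (ZMod.unitOfCoprime 4 (by norm_num) : (ZMod 11)ˣ))
      _ _ fun k => ?_).symm
    rw [Units.mulLeft_apply, ZMod.coe_unitOfCoprime, ← pow_mul]
    congr 1
    rw [pow_eq_pow_mod (3 * _) hv]
    congr 1
    revert k
    decide
  have hsum0 : ∑ k, ((y (4 * k) - y k : ℤ) : R) * w ^ k.val = 0 := by
    simp only [Int.cast_sub, sub_mul, Finset.sum_sub_distrib]
    rw [← hshift w hw.pow_eq_one, ← hXy w hw.pow_eq_one, ← hXy _ (by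
      rw [← pow_mul, mul_comm, pow_mul, hw.pow_eq_one, one_pow]), ← hσw, ← map_rootSum,
      ← map_rootSum, ← map_sub, hσX, sub_self]
  have hconst := coeff_eq_of_sum_mul_root_pow_eq_zero hw
    (a := fun k => ((y (4 * k) - y k : ℤ) : R)) (fun t ht0 ht1 => by
      obtain ⟨s, hs, hst⟩ := exists_coprime_five_mul_eleven_pow (N + 1) ht0 ht1
      obtain ⟨τ, hτ, -, -⟩ := h.exists_pow s hs
      have h1 := congrArg τ hsum0
      rw [map_sum, map_zero] at h1
      rw [← h1]
      refine Finset.sum_congr rfl fun k _ => ?_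
      rw [map_mul, map_intCast, map_pow, hτ w (hroot w hw.pow_eq_one),
        pow_eq_pow_mod s hw.pow_eq_one, hst])
  have hy4 : ∀ k, y (4 * k) = y k := fun k => by
    have h1 := hconst k 0
    simp only [mul_zero, sub_self, Int.cast_zero, Int.cast_eq_zero] at h1
    exact sub_eq_zero.mp h1
  have e4 : y 4 = y 1 := hy4 1
  have e5 : y 5 = y 1 := (hy4 4).trans e4
  have e9 : y 9 = y 1 := (hy4 5).trans e5
  have e3 : y 3 = y 1 := (hy4 9).trans e9
  have e8 : y 8 = y 2 := hy4 2
  have e10 : y 10 = y 2 := (hy4 8).trans e8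
  have e7 : y 7 = y 2 := (hy4 10).trans e10
  have e6 : y 6 = y 2 := (hy4 7).trans e7
  have hX' : rootSum w A - rootSum w B =
      y 0 + y 1 * gaussPeriod w + y 2 * gaussPeriod' w := by
    rw [hXy w hw.pow_eq_one, gaussPeriod, gaussPeriod']
    have : ∑ k : ZMod 11, (y k : R) * w ^ k.val = y 0 * w ^ 0 + y 1 * w ^ 1 + y 2 * w ^ 2 +
        y 3 * w ^ 3 + y 4 * w ^ 4 + y 5 * w ^ 5 + y 6 * w ^ 6 + y 7 * w ^ 7 + y 8 * w ^ 8 +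
        y 9 * w ^ 9 + y 10 * w ^ 10 := sum_zmod_eleven _
    rw [this, e4, e5, e9, e3, e8, e10, e7, e6]
    ring
  have hcw : c w = w ^ 10 := by
    have h1 := h.conj_mul w (hroot w hw.pow_eq_one)
    calc c w = c w * (w ^ 11) := by rw [hw.pow_eq_one, mul_one]
      _ = c w * w * w ^ 10 := by ring
      _ = w ^ 10 := by rw [h1, one_mul]
  have hadd := gaussPeriod_add hw
  have hmul := gaussPeriod_mul hw
  have hpsum : ∑ k, (p k : ℤ) = 7 + ∑ k, (q k : ℤ) := by
    rw [hp, hq]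
    exact_mod_cast (by rw [sum_card_filter_natCast, sum_card_filter_natCast, hAB])
  have hqsum : ∑ k, (q k : ℤ) ≤ 4 := by
    rw [hq]
    exact_mod_cast (by rwa [sum_card_filter_natCast])
  rw [sum_zmod_eleven, sum_zmod_eleven] at hpsum
  rw [sum_zmod_eleven] at hqsum
  have hyp : ∀ k, y k + q k = p k := fun k => by rw [hy]; ring
  have hp0 : ∀ k, (0 : ℤ) ≤ p k := fun k => Int.natCast_nonneg (p k)
  have hq0 : ∀ k, (0 : ℤ) ≤ q k := fun k => Int.natCast_nonneg (q k)
  have hy1 : 0 ≤ y 1 := by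
    -- All negative terms together number at most 4, and y takes the same value on five classes, so
    -- that value cannot be negative.
    have : -4 ≤ 5 * y 1 := by
      linarith [hyp 1, hyp 3, hyp 4, hyp 5, hyp 9, hp0 1, hp0 3, hp0 4, hp0 5, hp0 9,
        hq0 0, hq0 2, hq0 6, hq0 7, hq0 8, hq0 10]
    clear * - this
    omega
  have hy2 : 0 ≤ y 2 := by
    have : -4 ≤ 5 * y 2 := by
      linarith [hyp 2, hyp 6, hyp 7, hyp 8, hyp 10, hp0 2, hp0 6, hp0 7, hp0 8, hp0 10,
        hq0 0, hq0 1, hq0 3, hq0 4, hq0 5, hq0 9]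
    clear * - this
    omega
  have hy0 : y 0 = 7 - 5 * y 1 - 5 * y 2 := by
    linarith [hyp 0, hyp 1, hyp 2, hyp 3, hyp 4, hyp 5, hyp 6, hyp 7, hyp 8, hyp 9, hyp 10]
  have hy12 : 5 * (y 1 + y 2) ≤ 11 := by
    linarith [hyp 1, hyp 2, hyp 3, hyp 4, hyp 5, hyp 6, hyp 7, hyp 8, hyp 9, hyp 10, hp0 0,
      hq0 0, hq0 1, hq0 2, hq0 3, hq0 4, hq0 5, hq0 6, hq0 7, hq0 8, hq0 9, hq0 10]
  have hcases : y 1 = 0 ∧ y 2 = 0 ∨ y 1 = 1 ∧ y 2 = 0 ∨ y 1 = 0 ∧ y 2 = 1 ∨ y 1 = 1 ∧ y 2 = 1 ∨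
      y 1 = 2 ∧ y 2 = 0 ∨ y 1 = 0 ∧ y 2 = 2 := by
    clear * - hy1 hy2 hy12
    omega
  rw [hX', map_add, map_add, map_mul, map_mul, map_intCast, map_intCast, map_intCast,
    map_gaussPeriod hw.pow_eq_one hcw, map_gaussPeriod' hw.pow_eq_one hcw, hy0] at hX
  rw [hX', hy0]
  rcases hcases with ⟨h1, h2⟩ | ⟨h1, h2⟩ | ⟨h1, h2⟩ | ⟨h1, h2⟩ | ⟨h1, h2⟩ | ⟨h1, h2⟩ <;>
    rw [h1, h2] at hX ⊢ <;> push_cast at hX ⊢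
  · have : (22 : R) = 0 := by linear_combination hX
    exact absurd this (by norm_num)
  · have : (22 : R) = 0 := by linear_combination -hX + hmul + 2 * hadd
    exact absurd this (by norm_num)
  · have : (22 : R) = 0 := by linear_combination -hX + hmul + 2 * hadd
    exact absurd this (by norm_num)
  · have : (11 : R) = 0 := by
      linear_combination -hX + (gaussPeriod w + gaussPeriod' w - 7) * hadd
    exact absurd this (by norm_num)
  · linear_combination 4 * gaussPeriod w * hadd - 4 * hmul
  · linear_combination 4 * gaussPeriod' w * hadd - 4 * hmul

end Base

/-! ### Eliminating the fifth roots of unity -/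

section TrivialCharacter

variable {R : Type*} [CommRing R] [IsDomain R] [CharZero R] {σ c : R →+* R}

theorem CyclotomicActions.quadratic_of_rootSum_sub {N : ℕ} [NeZero (5 * 11 ^ (N + 1))]
    (h : CyclotomicActions R (5 * 11 ^ (N + 1)) 3 σ c) {r : ℕ} (hr : r ≤ N) {z : R}
    (hz : IsPrimitiveRoot z (11 ^ (r + 1))) {A B : Multiset ℕ}
    (hAB : Multiset.card A = 7 + Multiset.card B) (hB : Multiset.card B ≤ 4)
    (hX : (rootSum z A - rootSum z B) * c (rootSum z A - rootSum z B) = 27)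
    (hσX : σ (rootSum z A - rootSum z B) = rootSum z A - rootSum z B) :
    (rootSum z A - rootSum z B) ^ 2 + 8 * (rootSum z A - rootSum z B) + 27 = 0 := by
  induction r generalizing z A B with
  | zero =>
    rw [zero_add, pow_one] at hz
    exact h.conductor_eleven hz hAB hB hX hσX
  | succ r ih =>
    obtain ⟨A', B', hAB', hB', he⟩ := h.descent_step (by omega) hz hAB hB hX hσX
    rw [he] at hX hσX ⊢
    exact ih (by omega) (hz.pow (pow_pos (by norm_num) _) (pow_succ' 11 (r + 1))) hAB' hB' hX hσX

omit [IsDomain R] [CharZero R] in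
theorem CyclotomicActions.iterate_map_root {n e : ℕ} (h : CyclotomicActions R n e σ c) {w : R}
    (hw : w ^ n = 1) (t : ℕ) : (σ ^ t) w = w ^ e ^ t := by
  induction t with
  | zero => simp
  | succ t ih =>
    rw [pow_succ', RingHom.mul_def, RingHom.comp_apply, ih, map_pow, h.map_root w hw, ← pow_mul,
      pow_succ']

theorem three_pow_emod_five {M : ℕ} (hM : Odd M) : 3 ^ M % 5 = 2 ∨ 3 ^ M % 5 = 3 := by
  obtain ⟨j, rfl⟩ := hM
  induction j with
  | zero => right; rfl
  | succ j ih =>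
    rw [show 3 ^ (2 * (j + 1) + 1) = 9 * 3 ^ (2 * j + 1) by ring]
    generalize 3 ^ (2 * j + 1) = x at ih ⊢
    omega

theorem three_pow_emod_eleven_pow (N : ℕ) : 3 ^ (5 * 11 ^ N) % 11 ^ (N + 1) = 1 := by
  have h := dvd_sub_pow_of_dvd_sub (R := ℤ) (p := 11) (a := 3 ^ 5) (b := 1) (by norm_num) N
  rw [one_pow, ← pow_mul] at h
  have h1 : 3 ^ (5 * 11 ^ N) ≡ 1 [MOD 11 ^ (N + 1)] := by
    refine (Nat.modEq_iff_dvd.mpr ?_).symm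
    push_cast
    exact_mod_cast h
  have h2 : 1 % 11 ^ (N + 1) = 1 := Nat.mod_eq_of_lt (Nat.one_lt_pow (by omega) (by norm_num))
  exact Eq.trans h1 h2

omit [CharZero R] in
/-- If the coefficients of a combination of the fifth roots of unity lie in the ring generated by
the roots of `11`-power order, then it vanishes only if all its coefficients agree. -/
theorem CyclotomicActions.coeff_eq_of_sum_eq_zero {N e : ℕ}
    (h : CyclotomicActions R (5 * 11 ^ (N + 1)) e σ c) {w z : R} (hw : IsPrimitiveRoot w 5)
    (hz : z ^ 11 ^ (N + 1) = 1) {a : ZMod 5 → R}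
    (ha : ∀ τ : R →+* R, τ z = z → ∀ k, τ (a k) = a k)
    (h0 : ∑ k, a k * w ^ k.val = 0) (i j : ZMod 5) : a i = a j := by
  have : Fact (Nat.Prime 5) := ⟨by norm_num⟩
  refine coeff_eq_of_sum_mul_root_pow_eq_zero hw (fun t ht0 ht1 => ?_) i j
  have hco : Nat.Coprime 5 (11 ^ (N + 1)) := Nat.Coprime.pow_right _ (by norm_num)
  obtain ⟨s, hs5, hs11⟩ := Nat.chineseRemainder hco t 1
  have hs5' : s % 5 = t := Eq.trans hs5 (Nat.mod_eq_of_lt ht1)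
  have hs11' : s % 11 ^ (N + 1) = 1 :=
    Eq.trans hs11 (Nat.mod_eq_of_lt (Nat.one_lt_pow N.succ_ne_zero (by norm_num)))
  obtain ⟨τ, hτ, -, -⟩ := h.exists_pow s (by
    refine Nat.Coprime.mul_right ?_ ?_
    · rw [Nat.coprime_comm, Nat.Prime.coprime_iff_not_dvd (by norm_num)]
      omega
    · rw [Nat.Coprime, Nat.gcd_comm, Nat.gcd_rec, hs11']
      simp)
  have h1 := congrArg τ h0
  rw [map_sum, map_zero] at h1
  rw [← h1]
  refine Finset.sum_congr rfl fun k _ => ?_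
  rw [map_mul, map_pow, ha τ _ k, hτ w, pow_eq_pow_mod s hw.pow_eq_one, hs5']
  · rw [pow_mul, hw.pow_eq_one, one_pow]
  · rw [hτ z (by rw [mul_comm, pow_mul, hz, one_pow]), pow_eq_pow_mod s hz, hs11', pow_one]

theorem sum_zmod_five {M : Type*} [AddCommMonoid M] (f : ZMod 5 → M) :
    ∑ k, f k = f 0 + f 1 + f 2 + f 3 + f 4 := by
  exact Fin.sum_univ_five f

/-- Since 27 ≡ 4² mod 11, m 0 - m 1 ≡ ±4. The sign + would need m 0 ≡ 2 and m k ≡ 9, a total of at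
least 38. The sign - gives m 0 ≡ 0 and m k ≡ 4, so exactly one count exceeds its least value, by 11.
-/
theorem row_counts {m : ZMod 5 → ℕ} (hm : ∑ k, m k = 27)
    (h : ∀ k ≠ 0, (11 : ℤ) ∣ ((m 0 : ℤ) - m k) ^ 2 - 27)
    (h' : ∀ k ≠ 0, (11 : ℤ) ∣ (m k : ℤ) - m 1) :
    (m 0 = 11 ∧ m 1 = 4) ∨ (m 0 = 0 ∧ ∃ k ≠ 0, m k = 4) := by
  rw [sum_zmod_five] at hm
  have h1 := h 1 (by decide)
  have h2 := h' 2 (by decide)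
  have h3 := h' 3 (by decide)
  have h4 := h' 4 (by decide)
  have hsq := sq_emod_eleven ((m 0 : ℤ) - m 1)
  have hk : (m 0 = 11 ∧ m 1 = 4) ∨ (m 0 = 0 ∧ (m 1 = 4 ∨ m 2 = 4 ∨ m 3 = 4 ∨ m 4 = 4)) := by
    have hd : ((m 0 : ℤ) - m 1) % 11 = 4 ∨ ((m 0 : ℤ) - m 1) % 11 = 7 := by
      clear * - hsq h1
      omega
    clear h1 hsq h h'
    generalize m 0 = a at *
    generalize m 1 = b at *
    generalize m 2 = d at *
    generalize m 3 = e at *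
    generalize m 4 = f at *
    have hb : b % 11 = 4 := by omega
    clear hd
    omega
  rcases hk with hk | ⟨h0, hk | hk | hk | hk⟩
  · exact Or.inl hk
  · exact Or.inr ⟨h0, 1, by decide, hk⟩
  · exact Or.inr ⟨h0, 2, by decide, hk⟩
  · exact Or.inr ⟨h0, 3, by decide, hk⟩
  · exact Or.inr ⟨h0, 4, by decide, hk⟩

omit [CharZero R] in
theorem gaussSum_five_sq {w : R} (hw : IsPrimitiveRoot w 5) :
    (w - w ^ 2 - w ^ 3 + w ^ 4) ^ 2 = 5 := by
  have h := hw.geom_sum_eq_zero (by norm_num)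
  simp only [Finset.sum_range_succ, Finset.sum_range_zero] at h
  linear_combination (w ^ 4 - 3 * w ^ 3 + w ^ 2 + 5 * w - 5) * h

theorem CyclotomicActions.quadratic_of_map_eq {N : ℕ} [NeZero (5 * 11 ^ (N + 1))]
    (h : CyclotomicActions R (5 * 11 ^ (N + 1)) 3 σ c) {w z : R} (hw : IsPrimitiveRoot w 5)
    (hz : IsPrimitiveRoot z (11 ^ (N + 1))) {ι : Type*} [Fintype ι] (hι : Fintype.card ι = 27)
    (a b : ι → ℕ) {X : R} (hXab : X = ∑ i, w ^ a i * z ^ b i) (hX : X * c X = 27)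
    (hσX : σ X = X ∨ σ X = -X) : X ^ 2 + 8 * X + 27 = 0 := by
  classical
  have hwn : w ^ (5 * 11 ^ (N + 1)) = 1 := by rw [pow_mul, hw.pow_eq_one, one_pow]
  have hzn : z ^ (5 * 11 ^ (N + 1)) = 1 := by rw [mul_comm, pow_mul, hz.pow_eq_one, one_pow]
  set D : ZMod 5 → Multiset ℕ := fun k =>
    (Finset.univ.filter fun i => (a i : ZMod 5) = k).val.map b with hD
  have hDW : ∀ (v : R) (k : ZMod 5), rootSum v (D k) = ∑ i with (a i : ZMod 5) = k, v ^ b i := fun v k => by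
    simp only [hD, rootSum, Multiset.map_map]
    rfl
  have hsum : ∀ v : R, v ^ 5 = 1 → ∑ i, v ^ a i * z ^ b i = ∑ k, rootSum z (D k) * v ^ k.val := by
    intro v hv
    rw [← Finset.sum_fiberwise Finset.univ fun i => (a i : ZMod 5)]
    refine Finset.sum_congr rfl fun k _ => ?_
    rw [hDW, Finset.sum_mul]
    refine Finset.sum_congr rfl fun i hi => ?_
    rw [← (Finset.mem_filter.mp hi).2, ZMod.val_natCast, ← pow_eq_pow_mod _ hv, mul_comm]
  have hDcard : ∑ k, Multiset.card (D k) = 27 := by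
    rw [← hι, ← Finset.card_univ, Finset.card_eq_sum_card_fiberwise
      (f := fun i => (a i : ZMod 5)) (t := Finset.univ) (fun _ _ => Finset.mem_coe.mpr
        (Finset.mem_univ _))]
    refine Finset.sum_congr rfl fun k _ => ?_
    simp only [hD, Multiset.card_map]
    rfl
  -- As 3⁵ ≡ 1 mod 11, this power of σ fixes z. Its exponent is odd, so it raises w to the power 2
  -- or 3, both generators of (ℤ/5)ˣ, and it keeps the sign in σX = ±X.
  set ρ := σ ^ (5 * 11 ^ N) with hρ
  have hodd : Odd (5 * 11 ^ N) := by
    rw [Nat.odd_mul]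
    exact ⟨by decide, Odd.pow (by decide)⟩
  have hρX : σ X = X ∧ ρ X = X ∨ ρ X = -X := by
    rcases hσX with h1 | h1
    · left
      have : ∀ t : ℕ, (σ ^ t) X = X := fun t => by
        induction t with
        | zero => rfl
        | succ t ih => rw [pow_succ', RingHom.mul_def, RingHom.comp_apply, ih, h1]
      exact ⟨h1, this _⟩
    · right
      have : ∀ t : ℕ, (σ ^ t) X = (-1) ^ t * X := fun t => by
        induction t with
        | zero => simp
        | succ t ih =>
          rw [pow_succ', RingHom.mul_def, RingHom.comp_apply, ih, map_mul, h1, map_pow, map_neg,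
            map_one]
          ring
      rw [hρ, this, hodd.neg_one_pow, neg_one_mul]
  have hρz : ρ z = z := by
    rw [hρ, h.iterate_map_root hzn, pow_eq_pow_mod _ hz.pow_eq_one, three_pow_emod_eleven_pow,
      pow_one]
  -- u is the inverse mod 5 of the exponent by which ρ acts on w.
  obtain ⟨u, hu, hρw⟩ : ∃ u : (ZMod 5)ˣ, (u.val = 2 ∨ u.val = 3) ∧
      ∀ k : ZMod 5, (ρ w) ^ (u.val * k).val = w ^ k.val := by
    have hρw : ρ w = w ^ (3 ^ (5 * 11 ^ N) % 5) := by
      rw [hρ, h.iterate_map_root hwn, pow_eq_pow_mod _ hw.pow_eq_one]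
    rcases three_pow_emod_five hodd with h1 | h1 <;> rw [h1] at hρw
    · refine ⟨ZMod.unitOfCoprime 3 (by norm_num), Or.inr rfl, fun k => ?_⟩
      rw [hρw, ← pow_mul, pow_eq_pow_mod _ hw.pow_eq_one]
      congr 1
      revert k
      decide
    · refine ⟨ZMod.unitOfCoprime 2 (by norm_num), Or.inl rfl, fun k => ?_⟩
      rw [hρw, ← pow_mul, pow_eq_pow_mod _ hw.pow_eq_one]
      congr 1
      revert k
      decide
  set W : ZMod 5 → R := fun k => rootSum z (D k) with hW
  have hXW : X = ∑ k, W k * w ^ k.val := hXab.trans (hsum w hw.pow_eq_one)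
  have hρXW : ρ X = ∑ k, W (u.val * k) * w ^ k.val := by
    rw [hXab, map_sum]
    simp only [map_mul, map_pow, hρz]
    rw [hsum (ρ w) (by rw [← map_pow, hw.pow_eq_one, map_one])]
    refine (Fintype.sum_equiv (Units.mulLeft u) _ _ fun k => ?_).symm
    rw [Units.mulLeft_apply, hρw]
  have hWfix : ∀ τ : R →+* R, τ z = z → ∀ k, τ (W k) = W k := fun τ hτ k => by
    rw [hW]
    simp only [map_rootSum, hτ]
  have hgeom : 1 + w + w ^ 2 + w ^ 3 + w ^ 4 = 0 := by
    simpa [Finset.sum_range_succ] using hw.geom_sum_eq_zero (by norm_num)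
  have hX5 : X = W 0 * w ^ 0 + W 1 * w ^ 1 + W 2 * w ^ 2 + W 3 * w ^ 3 + W 4 * w ^ 4 :=
    hXW.trans (sum_zmod_five _)
  rcases hρX with ⟨hσX, hρX⟩ | hρX
  · have hconst := h.coeff_eq_of_sum_eq_zero hw hz.pow_eq_one
      (a := fun k => W (u.val * k) - W k) (fun τ hτ k => by
        rw [map_sub, hWfix τ hτ, hWfix τ hτ]) (by
        simp only [sub_mul, Finset.sum_sub_distrib]
        rw [← hρXW, ← hXW, hρX, sub_self])
    have hWu : ∀ k, W (u.val * k) = W k := fun k => by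
      have := hconst k 0
      simpa [sub_eq_zero] using this
    have hW1 : ∀ k ≠ 0, W k = W 1 := by
      rcases hu with hu | hu <;> rw [hu] at hWu
      · have e2 : W 2 = W 1 := hWu 1
        have e4 : W 4 = W 1 := (hWu 2).trans e2
        have e3 : W 3 = W 1 := (hWu 4).trans e4
        intro k hk
        have : k = 1 ∨ k = 2 ∨ k = 3 ∨ k = 4 := by revert k; decide
        rcases this with rfl | rfl | rfl | rfl <;> first | rfl | assumption
      · have e3 : W 3 = W 1 := hWu 1
        have e4 : W 4 = W 1 := (hWu 3).trans e3
        have e2 : W 2 = W 1 := (hWu 4).trans e4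
        intro k hk
        have : k = 1 ∨ k = 2 ∨ k = 3 ∨ k = 4 := by revert k; decide
        rcases this with rfl | rfl | rfl | rfl <;> first | rfl | assumption
    have hX01 : X = W 0 - W 1 := by
      rw [hX5, hW1 2 (by decide), hW1 3 (by decide), hW1 4 (by decide)]
      linear_combination W 1 * hgeom
    have : Fact (Nat.Prime 11) := ⟨by norm_num⟩
    obtain ⟨F, _, hF, π, hπ⟩ := h.exists_reduction 11
    have hdvdF : ∀ a : ℤ, (a : F) = 0 → (11 : ℤ) ∣ a := fun a ha => by
      exact_mod_cast (CharP.intCast_eq_zero_iff F 11 a).mp ha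
    have hπz : π z = 1 := hπ z _ hz.pow_eq_one
    have hπcz : π (c z) = 1 := by
      have := congrArg π (h.conj_mul z hzn)
      rwa [map_mul, hπz, mul_one, map_one] at this
    have hπW : ∀ k, π (W k) = Multiset.card (D k) := fun k => by
      rw [hW]
      simp only [map_rootSum, hπz, rootSum_one]
    have hπcW : ∀ k, π (c (W k)) = Multiset.card (D k) := fun k => by
      rw [hW]
      simp only [map_rootSum, hπcz, rootSum_one]
    have hX0k : ∀ k ≠ 0, X = W 0 - W k := fun k hk => by rw [hX01, hW1 k hk]
    rcases row_counts hDcard (fun k hk => hdvdF _ (by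
        have h1 := congrArg π hX
        rw [map_mul, hX0k k hk, map_sub, map_sub, map_sub, hπW, hπW, hπcW, hπcW, map_ofNat] at h1
        push_cast
        rw [sq, h1, sub_self])) (fun k hk => hdvdF _ (by
        push_cast
        rw [← hπW, ← hπW, hW1 k hk, sub_self])) with ⟨h1, h2⟩ | ⟨h1, k, hk, h2⟩
    · rw [hX01] at hX hσX ⊢
      exact h.quadratic_of_rootSum_sub le_rfl hz (by rw [h1, h2]) h2.le hX hσX
    · exfalso
      have hXk := hX0k k hk
      rw [hW] at hXk
      simp only at hXk
      rw [Multiset.card_eq_zero.mp h1, rootSum_zero, zero_sub] at hXk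
      rw [hXk] at hX
      exact h.neg_rootSum_mul_conj_ne hzn h2.le hX
  · exfalso
    have hconst := h.coeff_eq_of_sum_eq_zero hw hz.pow_eq_one
      (a := fun k => W (u.val * k) + W k) (fun τ hτ k => by
        rw [map_add, hWfix τ hτ, hWfix τ hτ]) (by
        simp only [add_mul, Finset.sum_add_distrib]
        rw [← hρXW, ← hXW, hρX, neg_add_cancel])
    have hWu : ∀ k, W (u.val * k) = 2 * W 0 - W k := fun k => by
      have := hconst k 0
      simp only [mul_zero] at this
      linear_combination this
    -- W k - W 0 changes sign under k ↦ uk, so it is a multiple of the quadratic character mod 5;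
    -- the second factor is the Gauss sum, of square 5.
    have hXV : X = (W 1 - W 0) * (w - w ^ 2 - w ^ 3 + w ^ 4) := by
      rcases hu with hu | hu <;> rw [hu] at hWu
      · have e2 : W 2 = 2 * W 0 - W 1 := hWu 1
        have e4 : W 4 = 2 * W 0 - W 2 := hWu 2
        have e3 : W 3 = 2 * W 0 - W 4 := hWu 4
        rw [hX5, e3, e4, e2]
        linear_combination W 0 * hgeom
      · have e3 : W 3 = 2 * W 0 - W 1 := hWu 1
        have e4 : W 4 = 2 * W 0 - W 3 := hWu 3
        have e2 : W 2 = 2 * W 0 - W 4 := hWu 4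
        rw [hX5, e2, e4, e3]
        linear_combination W 0 * hgeom
    have hcw : c w = w ^ 4 := by
      have h1 := h.conj_mul w hwn
      calc c w = c w * w ^ 5 := by rw [hw.pow_eq_one, mul_one]
        _ = c w * w * w ^ 4 := by ring
        _ = w ^ 4 := by rw [h1, one_mul]
    have hcs : c (w - w ^ 2 - w ^ 3 + w ^ 4) = w - w ^ 2 - w ^ 3 + w ^ 4 := by
      have h5 := hw.pow_eq_one
      simp only [map_add, map_sub, map_pow, hcw]
      linear_combination (w ^ 11 + w ^ 6 + w - w ^ 7 - w ^ 2 - w ^ 3) * h5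
    obtain ⟨P, hP, hP5⟩ := h.exists_maximal 5 (by norm_num)
    have h27 : (27 : R) = (5 : ℕ) * ((W 1 - W 0) * c (W 1 - W 0)) := by
      rw [← hX, hXV, map_mul, hcs, Nat.cast_ofNat, ← gaussSum_five_sq hw]
      ring
    have h27P : (27 : R) ∈ P := h27 ▸ P.mul_mem_right _ hP5
    refine hP.ne_top ((Ideal.eq_top_iff_one P).mpr ?_)
    -- 11 · 5 - 2 · 27 = 1.
    have := P.sub_mem (P.mul_mem_left 11 hP5) (P.mul_mem_left 2 h27P)
    norm_num at this
    exact this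

end TrivialCharacter

/-! ### Character sums of norm 27, up to a root of unity -/

section NormTwentySeven

open NumberField

theorem exists_ringOfIntegers_primitiveRoot (n : ℕ) [NeZero n] :
    ∃ (K : Type) (_ : Field K) (_ : NumberField K) (_ : IsCyclotomicExtension {n} ℚ K) (ζ : 𝓞 K),
      IsPrimitiveRoot ζ n := by
  have h : IsCyclotomicExtension {n} ℚ (CyclotomicField n ℚ) := by
    convert CyclotomicField.isCyclotomicExtension n ℚ
    · rfl
    · exact Subsingleton.elim _ _
  exact ⟨CyclotomicField n ℚ, inferInstance, inferInstance, h, _,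
    (IsCyclotomicExtension.zeta_spec n ℚ (CyclotomicField n ℚ)).toInteger_isPrimitiveRoot⟩

theorem exists_cyclotomicActions {K : Type*} [Field K] [NumberField K] {n : ℕ} [NeZero n]
    [IsCyclotomicExtension {n} ℚ K] {ζ : 𝓞 K} (hζ : IsPrimitiveRoot ζ n) {e : ℕ}
    (he : e.Coprime n) : ∃ σ c : 𝓞 K →+* 𝓞 K, CyclotomicActions (𝓞 K) n e σ c ∧
      (∀ x, c (c x) = x) ∧
      ∀ (φ : 𝓞 K →+* ℂ) (x : 𝓞 K), φ (c x) = starRingEnd ℂ (φ x) := by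
  obtain ⟨σ, hσ⟩ := exists_ringHom_primitiveRoot_pow hζ he
  obtain ⟨c, hc1, hcc, hcφ, hσc⟩ := exists_conjugation hζ
  obtain ⟨φ, -, -⟩ := exists_complexEmbedding_map_primitiveRoot hζ
    (Complex.isPrimitiveRoot_exp n (NeZero.ne n))
  refine ⟨σ, c, ⟨fun w hw => map_root_of_map_primitiveRoot hζ hσ hw, hc1, fun a ha => ?_,
    ⟨φ, hcφ φ⟩, fun p hp => exists_isMaximal_natCast_mem K hp⟩, hcc, hcφ⟩
  obtain ⟨τ, hτ⟩ := exists_ringHom_primitiveRoot_pow hζ ha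
  refine ⟨τ, fun w hw => map_root_of_map_primitiveRoot hζ hτ hw, hσc τ, ?_⟩
  have : τ.comp σ = σ.comp τ := ringHom_ext_of_primitiveRoot hζ (by
    simp only [RingHom.comp_apply, hσ, hτ, map_pow]
    rw [← pow_mul, ← pow_mul, mul_comm])
  exact fun x => DFunLike.congr_fun this x

theorem coprime_five_mul_eleven_pow {a : ℕ} (h5 : a.Coprime 5) (h11 : a.Coprime 11) (N : ℕ) :
    a.Coprime (5 * 11 ^ N) :=
  h5.mul_right (h11.pow_right _)

theorem exists_shift_quadratic {K : Type*} [Field K] [NumberField K] {N : ℕ}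
    [NeZero (5 * 11 ^ (N + 1))] [IsCyclotomicExtension {5 * 11 ^ (N + 1)} ℚ K] {ζ : 𝓞 K}
    (hζ : IsPrimitiveRoot ζ (5 * 11 ^ (N + 1))) {c : 𝓞 K →+* 𝓞 K}
    (hcφ : ∀ (φ : 𝓞 K →+* ℂ) (x : 𝓞 K), φ (c x) = starRingEnd ℂ (φ x))
    {ι : Type*} [Fintype ι] (hι : Fintype.card ι = 27)
    (g : ι → ℕ) (hX : (∑ i, ζ ^ g i) * c (∑ i, ζ ^ g i) = 27) :
    ∃ s : ℕ, (ζ ^ s * ∑ i, ζ ^ g i) ^ 2 + 8 * (ζ ^ s * ∑ i, ζ ^ g i) + 27 = 0 := by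
  obtain ⟨σ, c', h, -, hcφ'⟩ := exists_cyclotomicActions hζ (e := 3)
    (coprime_five_mul_eleven_pow (by norm_num) (by norm_num) _)
  obtain ⟨φ, hφ, -⟩ := exists_complexEmbedding_map_primitiveRoot hζ
    (Complex.isPrimitiveRoot_exp _ (NeZero.ne (5 * 11 ^ (N + 1))))
  obtain rfl : c = c' := RingHom.ext fun x => hφ (by rw [hcφ, hcφ'])
  have hodd : Odd (5 * 11 ^ (N + 1)) := by
    rw [Nat.odd_mul]
    exact ⟨by decide, Odd.pow (by decide)⟩
  have hσζ : σ ζ = ζ ^ 3 := h.map_root ζ hζ.pow_eq_one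
  set X : 𝓞 K := ∑ i, ζ ^ g i with hXdef
  have hX0 : X ≠ 0 := by
    intro h0
    rw [h0, zero_mul] at hX
    exact absurd hX.symm (by norm_num)
  have : Fact (Nat.Prime 3) := ⟨by norm_num⟩
  have hmap := map_le_self_of_dvd_prime_pow hζ (p := 3) hσζ (N := 3) (Ideal.span {X}) (by
    rw [Ideal.span_singleton_pow, Ideal.dvd_span_singleton, Ideal.mem_span_singleton]
    exact ⟨c X, by rw [hX]; norm_num⟩)
  obtain ⟨u, hu⟩ := Ideal.mem_span_singleton.mp
    (hmap (Ideal.mem_map_of_mem σ (Ideal.mem_span_singleton_self X)))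
  have hcσ : ∀ x, σ (c x) = c (σ x) := fun x => hφ (by
    rw [hcφ]
    exact hcφ (φ.comp σ) x |>.symm ▸ rfl)
  have huu : u * c u = 1 := by
    have h1 := congrArg σ hX
    rw [map_mul, hcσ, hu, map_mul, map_ofNat] at h1
    have h27 : (27 : 𝓞 K) ≠ 0 := by norm_num
    refine mul_left_cancel₀ h27 ?_
    rw [mul_one]
    calc (27 : 𝓞 K) * (u * c u) = X * c X * (u * c u) := by rw [hX]
      _ = X * u * (c X * c u) := by ring
      _ = 27 := h1
  obtain ⟨k, rfl⟩ := eq_neg_pow_of_mul_conj_eq_one hζ hodd hcφ huu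
  obtain ⟨d, hd⟩ := hodd
  -- With n = 2d + 1, the exponent 3kd + k equals kd + kn, so multiplying by ζ ^ (kd) absorbs the
  -- factor ζ ^ k and leaves only the sign.
  refine ⟨k * d, ?_⟩
  have hσX : σ (ζ ^ (k * d) * X) = (-1) ^ k * (ζ ^ (k * d) * X) := by
    rw [map_mul, hu, map_pow, hσζ, neg_pow]
    have h1 : ζ ^ (k * (2 * d + 1)) = 1 := by
      rw [← hd, mul_comm, pow_mul, hζ.pow_eq_one, one_pow]
    calc (ζ ^ 3) ^ (k * d) * (X * ((-1) ^ k * ζ ^ k))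
        = ζ ^ (k * (2 * d + 1)) * ((-1) ^ k * (ζ ^ (k * d) * X)) := by ring
      _ = _ := by rw [h1, one_mul]
  obtain ⟨t, ht⟩ : ∃ t, 11 ^ (N + 1) = 1 + 5 * t := by
    have : 11 ^ (N + 1) % 5 = 1 := by rw [Nat.pow_mod]; simp
    exact ⟨11 ^ (N + 1) / 5, by omega⟩
  set Q := 11 ^ (N + 1) with hQ
  have hQ0 : 0 < Q := by omega
  have hw : IsPrimitiveRoot (ζ ^ Q) 5 := hζ.pow (NeZero.pos _) (mul_comm 5 Q)
  have hz : IsPrimitiveRoot (ζ ^ 5) Q := hζ.pow (NeZero.pos _) rfl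
  -- Since Q = 1 + 5t, the exponent Q + 5(Q - t) equals 5Q + 1.
  have hζwz : ζ = ζ ^ Q * (ζ ^ 5) ^ (Q - t) := by
    rw [← pow_mul, ← pow_add, show Q + 5 * (Q - t) = 5 * Q + 1 by omega, pow_succ, hζ.pow_eq_one,
      one_mul]
  refine h.quadratic_of_map_eq hw hz hι (fun i => k * d + g i)
    (fun i => (Q - t) * (k * d + g i)) ?_ ?_ ?_
  · rw [hXdef, Finset.mul_sum]
    refine Finset.sum_congr rfl fun i _ => ?_
    rw [pow_mul (ζ ^ 5), ← mul_pow, ← hζwz, pow_add]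
  · rw [map_mul]
    have h1 := h.conj_mul (ζ ^ (k * d)) (by
      rw [← pow_mul, mul_comm, pow_mul, hζ.pow_eq_one, one_pow])
    calc ζ ^ (k * d) * X * (c (ζ ^ (k * d)) * c X)
        = c (ζ ^ (k * d)) * ζ ^ (k * d) * (X * c X) := by ring
      _ = 27 := by rw [h1, one_mul, hX]
  · rw [hσX]
    rcases neg_one_pow_eq_or (𝓞 K) k with h1 | h1 <;> rw [h1]
    · left; rw [one_mul]
    · right; rw [neg_one_mul]

/-- A sum of `27` roots of unity of order dividing `5 * 11 ^ (N + 1)` with absolute value `√27` is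
a root of unity times a root of `X ^ 2 + 8 * X + 27`. -/
theorem exists_root_of_unity_mul_quadratic {N : ℕ} {μ : ℂ}
    (hμ : IsPrimitiveRoot μ (5 * 11 ^ (N + 1))) {ι : Type*} [Fintype ι]
    (hι : Fintype.card ι = 27) (g : ι → ℕ) (hX : ‖∑ i, μ ^ g i‖ ^ 2 = 27) :
    ∃ s : ℕ, (μ ^ s * ∑ i, μ ^ g i) ^ 2 + 8 * (μ ^ s * ∑ i, μ ^ g i) + 27 = 0 := by
  have : NeZero (5 * 11 ^ (N + 1)) := ⟨by positivity⟩
  obtain ⟨K, _, _, _, ζ, hζ⟩ := exists_ringOfIntegers_primitiveRoot (5 * 11 ^ (N + 1))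
  obtain ⟨φ, hφ, hφμ⟩ := exists_complexEmbedding_map_primitiveRoot hζ hμ
  obtain ⟨c, -, -, hcφ, -⟩ := exists_conjugation hζ
  have hφX : φ (∑ i, ζ ^ g i) = ∑ i, μ ^ g i := by
    rw [map_sum]
    simp only [map_pow, hφμ]
  obtain ⟨s, hs⟩ := exists_shift_quadratic hζ hcφ hι g (hφ (by
    rw [map_mul, hcφ, Complex.mul_conj, Complex.normSq_eq_norm_sq, hφX, hX, map_ofNat]
    norm_num))
  refine ⟨s, ?_⟩
  have h1 := congrArg φ hs
  simpa only [map_add, map_mul, map_pow, map_ofNat, map_zero, hφX, hφμ] using h1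

end NormTwentySeven

/-! ### Comparing all characters at the primes above 3 -/

section AllCharacters

open NumberField

theorem sub_one_mem_of_pow_three_eq_one {R : Type*} [CommRing R] {P : Ideal R} [hP : P.IsPrime]
    (h3 : (3 : R) ∈ P) {w : R} (hw : w ^ 3 = 1) : w - 1 ∈ P := by
  refine hP.mem_of_pow_mem 3 ?_
  rw [show (w - 1) ^ 3 = (w - w ^ 2) * 3 by linear_combination hw]
  exact P.mul_mem_left _ h3

theorem eq_one_of_pow_eq_one_of_sub_one_mem {R : Type*} [CommRing R] [IsDomain R] {P : Ideal R}
    {w : R} {k : ℕ} (hw : w ^ k = 1) (h1 : w - 1 ∈ P) (hk : (k : R) ∉ P) : w = 1 := by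
  have hsum : (w - 1) * ∑ i ∈ Finset.range k, w ^ i = 0 := by
    rw [mul_geom_sum, hw, sub_self]
  refine sub_eq_zero.mp ((mul_eq_zero.mp hsum).resolve_right fun h0 => hk ?_)
  have h2 : ∑ i ∈ Finset.range k, (w ^ i - 1) ∈ P := P.sum_mem fun i _ => by
    obtain ⟨d, hd⟩ := sub_one_dvd_pow_sub_one w i
    rw [hd]
    exact P.mul_mem_right _ h1
  rw [Finset.sum_sub_distrib, h0] at h2
  simpa using h2

/-- There is no family `X ψ` of algebraic integers of absolute value `√27`, congruent to each other
modulo all primes above `3`, such that `X 0` is associated to a root of `X ^ 2 + 8 * X + 27`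
and the sum of the family is `27` times a unit. -/
theorem not_exists_family {K : Type*} [Field K] [NumberField K] {m : ℕ} [NeZero (3 * m)]
    (hm : Odd (3 * m)) (h3m : ¬ 3 ∣ m) [IsCyclotomicExtension {3 * m} ℚ K] {ζ : 𝓞 K}
    (hζ : IsPrimitiveRoot ζ (3 * m)) {c : 𝓞 K →+* 𝓞 K} (hcc : ∀ x, c (c x) = x)
    (hcφ : ∀ (φ : 𝓞 K →+* ℂ) (x : 𝓞 K), φ (c x) = starRingEnd ℂ (φ x))
    {I : Type*} [Fintype I] (hI : Fintype.card I = 27) {X : I → 𝓞 K} (hX : ∀ i, X i * c (X i) = 27)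
    (hcong : ∀ P : Ideal (𝓞 K), P.IsPrime → (3 : 𝓞 K) ∈ P → ∀ i j,
      X i - X j ∈ P ∧ c (X i) - c (X j) ∈ P)
    {o : I} {v : 𝓞 K} (hv : v * c v = 1)
    (hq : (v * X o) ^ 2 + 8 * (v * X o) + 27 = 0) {y : 𝓞 K} (hy : IsUnit y)
    (hsum : ∑ i, X i = 27 * y) : False := by
  set α := v * X o with hα
  have hααc : α * c α = 27 := by
    rw [hα, map_mul]
    calc v * X o * (c v * c (X o)) = v * c v * (X o * c (X o)) := by ring
      _ = 27 := by rw [hv, hX, one_mul]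
  have hα0 : α ≠ 0 := by
    intro h0
    rw [h0, zero_mul] at hααc
    exact absurd hααc.symm (by norm_num)
  have hcα : c α = -8 - α := by
    refine mul_left_cancel₀ hα0 ?_
    linear_combination hααc + hq
  -- The trace α + c α = -8 is prime to 3: 3 · 3 - 8 = 1.
  have hnot : ∀ P : Ideal (𝓞 K), P.IsPrime → (3 : 𝓞 K) ∈ P → α ∈ P → c α ∉ P :=
    fun P hP h3 h1 h2 => by
      refine hP.ne_top ((Ideal.eq_top_iff_one P).mpr ?_)
      have := P.add_mem (P.mul_mem_left 3 h3) (P.add_mem h1 h2)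
      rw [hcα] at this
      convert this using 1
      ring
  have h27 : ∀ P : Ideal (𝓞 K), P.IsPrime → (27 : 𝓞 K) ∈ P → (3 : 𝓞 K) ∈ P := fun P hP h => by
    refine hP.mem_of_pow_mem 3 ?_
    norm_num
    exact h
  have hcop : ∀ i, IsCoprime α (c (X i)) := fun i => by
    rw [← Ideal.isCoprime_span_singleton_iff, Ideal.isCoprime_iff_sup_eq]
    by_contra hne
    obtain ⟨P, hPmax, hle⟩ := Ideal.exists_le_maximal _ hne
    have hP := hPmax.isPrime
    have h1 : α ∈ P := hle (Ideal.mem_sup_left (Ideal.mem_span_singleton_self _))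
    have h2 : c (X i) ∈ P := hle (Ideal.mem_sup_right (Ideal.mem_span_singleton_self _))
    have h3 : (3 : 𝓞 K) ∈ P := h27 P hP (hααc ▸ P.mul_mem_right _ h1)
    refine hnot P hP h3 h1 ?_
    rw [hα, map_mul]
    refine P.mul_mem_left _ ?_
    have h4 := P.sub_mem h2 (hcong P hP h3 i o).2
    rwa [sub_sub_cancel] at h4
  have hdvd : ∀ i, α ∣ X i := fun i => (hcop i).dvd_of_dvd_mul_right ⟨c α, by rw [hX, hααc]⟩
  choose β hβ using hdvd
  have hββ : ∀ i, β i * c (β i) = 1 := fun i => by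
    have h1 := hX i
    rw [hβ, map_mul] at h1
    refine mul_left_cancel₀ (show (27 : 𝓞 K) ≠ 0 by norm_num) ?_
    rw [mul_one]
    calc (27 : 𝓞 K) * (β i * c (β i)) = α * c α * (β i * c (β i)) := by rw [hααc]
      _ = α * β i * (c α * c (β i)) := by ring
      _ = 27 := h1
  -- By `hnot`, a prime above 3 or its conjugate avoids α. Modulo such a P, α can be cancelled from
  -- α β i ≡ α β o.
  obtain ⟨P, hP, h3P, hαP⟩ : ∃ P : Ideal (𝓞 K), P.IsPrime ∧ (3 : 𝓞 K) ∈ P ∧ α ∉ P := by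
    obtain ⟨P, hPmax, h3⟩ := exists_isMaximal_natCast_mem K (p := 3) (by norm_num)
    rw [Nat.cast_ofNat] at h3
    by_cases h : α ∈ P
    · refine ⟨P.comap c, hPmax.isPrime.comap c, ?_, fun h' => hnot P hPmax.isPrime h3 h h'⟩
      rw [Ideal.mem_comap, map_ofNat]
      exact h3
    · exact ⟨P, hPmax.isPrime, h3, h⟩
  set η : I → 𝓞 K := fun i => β i * c (β o) with hη
  have hη3 : ∀ i, η i ^ 3 = 1 := fun i => by
    have h1 : β i - β o ∈ P := by
      refine (hP.mem_or_mem (?_ : α * (β i - β o) ∈ P)).resolve_left hαP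
      rw [mul_sub, ← hβ, ← hβ]
      exact (hcong P hP h3P i o).1
    have h2 : η i - 1 ∈ P := by
      rw [← hββ o, hη]
      simp only
      rw [← sub_mul]
      exact P.mul_mem_right _ h1
    have h3 : η i * c (η i) = 1 := by
      rw [hη]
      simp only [map_mul, hcc]
      calc β i * c (β o) * (c (β i) * β o) = β i * c (β i) * (β o * c (β o)) := by ring
        _ = 1 := by rw [hββ, hββ, one_mul]
    obtain ⟨k, hk⟩ := eq_neg_pow_of_mul_conj_eq_one hζ hm hcφ h3
    -- η i is ± a root of unity of order dividing 3m, so its cube has order dividing 2m, which is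
    -- prime to 3; being 1 modulo P, the cube is 1.
    refine eq_one_of_pow_eq_one_of_sub_one_mem (k := 2 * m) (P := P) ?_ ?_ ?_
    · rw [hk, ← pow_mul, ← pow_mul, show k * (3 * (2 * m)) = 2 * ((3 * m) * k) by ring, pow_mul,
        neg_sq, ← pow_mul, show 2 * ((3 * m) * k) = (3 * m) * (2 * k) by ring, pow_mul,
        hζ.pow_eq_one, one_pow]
    · obtain ⟨d, hd⟩ := sub_one_dvd_pow_sub_one (η i) 3
      rw [hd]
      exact P.mul_mem_right _ h2
    · intro h4
      have hco : IsCoprime (3 : ℤ) ((2 * m : ℕ) : ℤ) := by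
        rw [show (3 : ℤ) = ((3 : ℕ) : ℤ) by norm_num, Nat.isCoprime_iff_coprime,
          Nat.Prime.coprime_iff_not_dvd (by norm_num), Nat.Prime.dvd_mul (by norm_num)]
        exact fun h => h.elim (by norm_num) h3m
      obtain ⟨a, b, hab⟩ := hco
      refine hP.ne_top ((Ideal.eq_top_iff_one P).mpr ?_)
      have h5 := congrArg (Int.cast : ℤ → 𝓞 K) hab
      push_cast at h5
      rw [← h5]
      refine P.add_mem (P.mul_mem_left _ h3P) (P.mul_mem_left _ ?_)
      exact_mod_cast h4
  have hsumη : ∑ i, η i = c α * (y * c (β o)) := by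
    refine mul_left_cancel₀ hα0 ?_
    calc α * ∑ i, η i = (∑ i, X i) * c (β o) := by
          rw [Finset.mul_sum, Finset.sum_mul]
          refine Finset.sum_congr rfl fun i _ => ?_
          rw [hη, hβ i]
          ring
      _ = α * c α * y * c (β o) := by rw [hsum, hααc]
      _ = _ := by ring
  have hcαP : c α ∈ P := by
    refine (hP.mem_or_mem (?_ : α * c α ∈ P)).resolve_left hαP
    rw [hααc, show (27 : 𝓞 K) = 9 * 3 by norm_num]
    exact P.mul_mem_left _ h3P
  have hP' : (P.comap c).IsPrime := hP.comap c
  have h3P' : (3 : 𝓞 K) ∈ P.comap c := by rwa [Ideal.mem_comap, map_ofNat]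
  -- The conjugate prime contains 3, hence the sum of 27 cube roots of unity, but not c α; this
  -- contradicts `hsumη`.
  have hηP' : ∑ i, η i ∈ P.comap c := by
    have h1 : ∑ i, (η i - 1) ∈ P.comap c :=
      Ideal.sum_mem _ fun i _ => sub_one_mem_of_pow_three_eq_one h3P' (hη3 i)
    rw [Finset.sum_sub_distrib, Finset.sum_const, Finset.card_univ, hI, nsmul_one] at h1
    have h2 := (P.comap c).add_mem h1 ((P.comap c).mul_mem_left 9 h3P')
    norm_num at h2
    rwa [Ideal.mem_comap, map_sum]
  rw [hsumη] at hηP'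
  have hu : IsUnit (y * c (β o)) := hy.mul (IsUnit.of_mul_eq_one (β o) (by rw [mul_comm, hββ]))
  have := (hP'.mem_or_mem hηP').resolve_right fun h => hP'.ne_top (Ideal.eq_top_of_isUnit_mem _ h hu)
  rw [Ideal.mem_comap, hcc] at this
  exact hαP this

theorem not_forall_norm_sq_eq {G : Type*} [AddCommGroup G] [Fintype G]
    (hG : Fintype.card G = 27) (hG3 : ∀ x : G, 3 • x = 0) {N : ℕ} {μ : ℂ}
    (hμ : IsPrimitiveRoot μ (5 * 11 ^ (N + 1))) (g : G → ℕ) :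
    ¬ ∀ χ : AddChar G ℂ, ‖∑ x, μ ^ g x * χ x‖ ^ 2 = 27 := by
  intro hbent
  classical
  obtain ⟨m, hm⟩ : ∃ m, m = 5 * 11 ^ (N + 1) := ⟨_, rfl⟩
  have hm0 : 0 < m := by rw [hm]; positivity
  have hmodd : Odd m := by
    rw [hm, Nat.odd_mul]
    exact ⟨by decide, Odd.pow (by decide)⟩
  have h3m : ¬ 3 ∣ m := by
    rw [← Nat.Prime.coprime_iff_not_dvd (by norm_num), hm]
    exact coprime_five_mul_eleven_pow (by norm_num) (by norm_num) _
  obtain ⟨s, hs⟩ := exists_root_of_unity_mul_quadratic hμ hG g (by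
    simpa using hbent 1)
  rw [← hm] at hμ
  have : NeZero (3 * m) := ⟨by omega⟩
  obtain ⟨K, _, _, _, ζ, hζ⟩ := exists_ringOfIntegers_primitiveRoot (3 * m)
  obtain ⟨φ, hφ, -⟩ := exists_complexEmbedding_map_primitiveRoot hζ
    (Complex.isPrimitiveRoot_exp (3 * m) (NeZero.ne _))
  obtain ⟨c, hc1, hcc, hcφ, -⟩ := exists_conjugation hζ
  have hφζ := hζ.map_of_injective hφ
  obtain ⟨z, hz⟩ : ∃ z : 𝓞 K, φ z = μ := by
    obtain ⟨j, -, hj⟩ := hφζ.eq_pow_of_pow_eq_one (ξ := μ) (by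
      rw [mul_comm, pow_mul, hμ.pow_eq_one, one_pow])
    exact ⟨ζ ^ j, by rw [map_pow, hj]⟩
  have hzn : z ^ (3 * m) = 1 := hφ (by
    rw [map_pow, hz, map_one, mul_comm, pow_mul, hμ.pow_eq_one, one_pow])
  have hω : IsPrimitiveRoot (ζ ^ m) 3 := hζ.pow (NeZero.pos _) (mul_comm 3 m)
  have hφω := hω.map_of_injective hφ
  have hchar : ∀ (χ : AddChar G ℂ) (x : G), ∃ w : 𝓞 K, w ^ 3 = 1 ∧ φ w = χ x := fun χ x => by
    obtain ⟨j, -, hj⟩ := hφω.eq_pow_of_pow_eq_one (ξ := χ x) (by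
      rw [← AddChar.map_nsmul_eq_pow, hG3, AddChar.map_zero_eq_one])
    refine ⟨(ζ ^ m) ^ j, ?_, by rw [map_pow, hj]⟩
    rw [← pow_mul, mul_comm, pow_mul, hω.pow_eq_one, one_pow]
  choose w hw3 hφw using hchar
  have hφX : ∀ χ : AddChar G ℂ, φ (∑ x, z ^ g x * w χ x) = ∑ x, μ ^ g x * χ x := fun χ => by
    simp only [map_sum, map_mul, map_pow, hz, hφw]
  have hcw3 : ∀ χ x, c (w χ x) ^ 3 = 1 := fun χ x => by rw [← map_pow, hw3, map_one]
  refine not_exists_family (m := m) (Odd.mul (by decide) hmodd) h3m hζ hcc hcφ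
    (I := AddChar G ℂ) (by rw [AddChar.card_eq, hG]) (X := fun χ => ∑ x, z ^ g x * w χ x)
    (fun χ => hφ ?_) (fun P hP h3 χ χ' => ?_) (o := 1) (v := z ^ s) ?_ (hφ ?_) (y := z ^ g 0) ?_
    (hφ ?_)
  · rw [map_mul, hcφ, Complex.mul_conj, Complex.normSq_eq_norm_sq, hφX, hbent, map_ofNat]
    norm_num
  · constructor
    · rw [← Finset.sum_sub_distrib]
      refine P.sum_mem fun x _ => ?_
      rw [← mul_sub, ← sub_sub_sub_cancel_right _ _ (1 : 𝓞 K)]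
      exact P.mul_mem_left _ (P.sub_mem (sub_one_mem_of_pow_three_eq_one h3 (hw3 _ _))
        (sub_one_mem_of_pow_three_eq_one h3 (hw3 _ _)))
    · simp only [map_sum, map_mul]
      rw [← Finset.sum_sub_distrib]
      refine P.sum_mem fun x _ => ?_
      rw [← mul_sub, ← sub_sub_sub_cancel_right _ _ (1 : 𝓞 K)]
      exact P.mul_mem_left _ (P.sub_mem (sub_one_mem_of_pow_three_eq_one h3 (hcw3 _ _))
        (sub_one_mem_of_pow_three_eq_one h3 (hcw3 _ _)))
  · rw [mul_comm]
    exact hc1 _ (by rw [← pow_mul, mul_comm, pow_mul, hzn, one_pow])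
  · have h1 : φ (∑ x, z ^ g x * w 1 x) = ∑ x, μ ^ g x := by
      rw [hφX]
      simp
    simp only [map_add, map_mul, map_pow, map_ofNat, map_zero, h1, hz]
    exact hs
  · exact (IsUnit.of_mul_eq_one _ (by
      rw [← pow_succ', Nat.sub_add_cancel (NeZero.pos (3 * m)), hzn])).pow _
  · rw [map_sum]
    simp only [hφX]
    rw [Finset.sum_comm]
    simp only [← Finset.mul_sum, AddChar.sum_apply_eq_ite]
    simp only [map_mul, map_pow, map_ofNat, hz]
    simp [hG, mul_comm]

end AllCharacters

theorem mainTheorem3 (r : ℕ) (ζ : ℂ) (hζ : IsPrimitiveRoot ζ (5 * 11 ^ r)) :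
    ¬ ∃ f : (Fin 3 → ZMod 3) → ZMod (5 * 11 ^ r), IsGeneralizedBent ζ f := by
  rintro ⟨f, hf⟩
  -- Raising the exponent by one covers r = 0, as the base case needs eleventh roots of unity.
  have hμ := Complex.isPrimitiveRoot_exp (5 * 11 ^ (r + 1)) (by positivity)
  obtain ⟨j, -, hj⟩ := hμ.eq_pow_of_pow_eq_one (ξ := ζ) (by
    rw [pow_succ, ← mul_assoc, pow_mul, hζ.pow_eq_one, one_pow])
  have hcard : Fintype.card (Fin 3 → ZMod 3) = 27 := by simp
  refine not_forall_norm_sq_eq hcard (fun x => ?_) hμ (fun x => j * (f x).val) fun χ => ?_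
  · funext i
    rw [Pi.smul_apply, nsmul_eq_mul, show ((3 : ℕ) : ZMod 3) = 0 from rfl, zero_mul]
    rfl
  · have h := hf χ
    rw [hcard, ← hj] at h
    simp only [pow_mul]
    exact_mod_cast h
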